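/- Let $X$ be a finite connected graph of diameter $d\ge 2$ that is distance-regular: for $0\le i\le d$ there are constants $a_i,b_i,c_i$ such that for any vertices $v,w$ at distance $i$, the vertex $w$ has exactly $a_i$, $b_i$, $c_i$ neighbours at distance $i$, $i+1$, $i-1$ from $v$, respectively. Let $k=b_0$ be the vertex degree, put $\mu=c_2$, and let $\theta_1$ and $-m$ be the second largest and the smallest distinct eigenvalue of the adjacency matrix of $X$. Assume that $X$ is geometric, i.e. there is a collection $\mathcal C$ of Delsarte cliques (cliques with exactly $1+k/m$ vertices) such that every edge of $X$ lies in exactly one clique of $\mathcal C$. Suppose that $\mu\ge 2$ and $\theta_1\ge(1-\varepsilon)b_1$, where $0<\varepsilon<\frac{1}{6m^4d}$. Assume moreover that $c_t\le\varepsilon k$ and $b_t\le\varepsilon k$ for some $t$ with $0\le t\le d$, and that for some vertex $v$ the neighborhood graph $X(v)$ (the subgraph induced on the set of neighbours of $v$) is disconnected. Then $X$ is isomorphic to the Hamming graph $H(d,s)$ with $s=1+k/d$ (in particular, $k/d$ is an integer). Here $H(d,s)$ is the graph on the $d$-tuples over a set of $s\ge 2$ points, two tuples being adjacent if and only if they differ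 in exactly one position. -/

import Mathlib

namespace SimpleGraph

variable {V : Type*} [Fintype V] [DecidableEq V]

/-- `G` is a connected graph of diameter `d`, and for any two vertices `v`, `w` at distance `i`, the
vertex `w` has exactly `a i`, `b i`, `c i` neighbours at distance `i`, `i + 1`, `i - 1` from `v`,
respectively. Only the values at indices `i ≤ d` are constrained; in particular `c 0 = 0` and
`b d = 0`. -/
structure IsDistanceRegularWith (G : SimpleGraph V) [DecidableRel G.Adj]
    (d : ℕ) (a b c : ℕ → ℕ) : Prop where
  connected : G.Connected
  diam_eq : G.diam = d
  card_same : ∀ v w : V,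
    ((G.neighborFinset w).filter (fun u => G.dist v u = G.dist v w)).card = a (G.dist v w)
  card_next : ∀ v w : V,
    ((G.neighborFinset w).filter (fun u => G.dist v u = G.dist v w + 1)).card = b (G.dist v w)
  card_prev : ∀ v w : V,
    ((G.neighborFinset w).filter (fun u => G.dist v u + 1 = G.dist v w)).card = c (G.dist v w)

/-- The set of eigenvalues of the adjacency matrix of `G`. -/
def adjEigenvalues (G : SimpleGraph V) [DecidableRel G.Adj] : Set ℝ :=
  {θ | Module.End.HasEigenvalue (Matrix.toLin' (G.adjMatrix ℝ)) θ}

/-- `θ` is the smallest eigenvalue of `G`. -/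
def IsSmallestEigenvalue (G : SimpleGraph V) [DecidableRel G.Adj] (θ : ℝ) : Prop :=
  IsLeast G.adjEigenvalues θ

/-- `θ` is the second largest among the distinct eigenvalues of `G`, that is, the largest eigenvalue
that is smaller than some other eigenvalue. -/
def IsSecondLargestEigenvalue (G : SimpleGraph V) [DecidableRel G.Adj] (θ : ℝ) : Prop :=
  IsGreatest {x | x ∈ G.adjEigenvalues ∧ ∃ y ∈ G.adjEigenvalues, x < y} θ

/-- A Delsarte clique of a regular graph: a clique of size `1 - k / θ`, where `k` is the degree and
`θ` is the smallest eigenvalue. -/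
def IsDelsarteClique (G : SimpleGraph V) [DecidableRel G.Adj] (C : Finset V) : Prop :=
  G.IsClique (C : Set V) ∧
    ∃ (k : ℕ) (θ : ℝ), G.IsRegularOfDegree k ∧ G.IsSmallestEigenvalue θ ∧
      (C.card : ℝ) = 1 - (k : ℝ) / θ

/-- There is a collection of Delsarte cliques such that every edge lies in exactly one of them. -/
def IsGeometric (G : SimpleGraph V) [DecidableRel G.Adj] : Prop :=
  ∃ 𝒞 : Set (Finset V), (∀ C ∈ 𝒞, G.IsDelsarteClique C) ∧
    ∀ u v : V, G.Adj u v → ∃! C : Finset V, C ∈ 𝒞 ∧ u ∈ C ∧ v ∈ C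

/-- The neighborhood graph of `v`: the subgraph induced on the set of neighbours of `v`. -/
abbrev neighborhoodGraph {W : Type*} (G : SimpleGraph W) (v : W) :
    SimpleGraph (G.neighborSet v) :=
  G.induce (G.neighborSet v)

/-- The Hamming graph `H(d, s)`: the vertices are the `d`-tuples over a set of `s` points, and two
of them are adjacent when they differ in exactly one position. -/
def hammingGraph (d s : ℕ) : SimpleGraph (Fin d → Fin s) where
  Adj x y := hammingDist x y = 1
  symm := ⟨fun x y h => by rwa [hammingDist_comm]⟩
  loopless := ⟨fun x h => by simp at h⟩

end SimpleGraph

namespace SimpleGraph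

set_option linter.unusedSectionVars false

/-! The smallest eigenvalue controls the cliques, and θ₁ controls the quadrangles.

For `-m`, a double count shows that every eigenfunction sums to zero over each clique of the
geometry (`sum_eq_zero`). Applied to eigenfunctions radial about a vertex `x` at distance one from a
clique, this forces the number of neighbours of `x` in the clique to be a constant (`card_adj_eq`).
A disconnected neighbourhood graph makes that constant 1 (`exists_card_adj_eq_one`), so the cliques
behave like lines and the graph has no diamonds.

For θ₁, the vertices are mapped to Euclidean space so that squared distances depend only on graph
distance: α for adjacent pairs, β for pairs at distance two. Since θ₁ is close to `b 1`, the defect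
`H x - H p + H y - H z` of a quadrangle is short. Hence quadrangles are determined by two edges and
can be transported along edges, completing to cubes (`quad_unique`, `transport_adj`, `cube`).
Summing the eigenvalue equation around a quadrangle writes θ₁ + 2 times its defect as a sum of fewer
than θ₁ + 2 defects, all of the same length (`smul_defect`). So every defect vanishes and β = 2α
(`add_eq_add`, `beta_eq`).

The lines through a vertex now span mutually orthogonal subspaces and give coordinates in which
squared distance is α times Hamming distance. Parallelograms propagate these coordinates through the
graph (`exists_isHammingCovering`), and the resulting covering of a Hamming graph preserves distance
(`dist_aux`), hence is an isomorphism. Comparing diameters identifies the number of lines through a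
vertex with `d`. -/

lemma exists_adj_dist_eq {V : Type*} {G : SimpleGraph V} (h : G.Connected) {x y : V} {i : ℕ}
    (hi : G.dist x y = i + 1) : ∃ z, G.Adj z y ∧ G.dist x z = i := by
  obtain ⟨p, hp⟩ := h.exists_walk_length_eq_dist x y
  refine ⟨p.getVert i, ?_, ?_⟩
  · have := p.adj_getVert_succ (i := i) (by omega)
    rwa [show i + 1 = p.length by omega, p.getVert_length] at this
  · have h1 : G.dist x (p.getVert i) ≤ i := (SimpleGraph.dist_le (p.take i)).trans (by simp)
    have h2 : G.dist (p.getVert i) y ≤ p.length - i :=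
      (SimpleGraph.dist_le (p.drop i)).trans (by simp)
    have h3 := h.dist_triangle (u := x) (v := p.getVert i) (w := y)
    omega

/-! ### Eigenfunctions and standard sequences of distance-regular graphs. -/

section Representation

variable {V : Type*} [Fintype V] [DecidableEq V]

/-- `g` is an eigenfunction of the adjacency operator with eigenvalue `θ` (possibly zero). -/
def IsEigenfunction (G : SimpleGraph V) [DecidableRel G.Adj] (θ : ℝ) (g : V → ℝ) : Prop :=
  ∀ x, ∑ w ∈ G.neighborFinset x, g w = θ * g x

/-- The sum of `g` over the sphere of radius `i` around `y`. -/
noncomputable def sphereSum (G : SimpleGraph V) (g : V → ℝ) (i : ℕ) (y : V) : ℝ :=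
  ∑ x, if G.dist y x = i then g x else 0

variable {G : SimpleGraph V} [DecidableRel G.Adj] {d : ℕ} {a b c : ℕ → ℕ}

lemma exists_isEigenfunction {θ : ℝ} (h : θ ∈ G.adjEigenvalues) :
    ∃ f : V → ℝ, f ≠ 0 ∧ G.IsEigenfunction θ f := by
  obtain ⟨f, hf⟩ := Module.End.HasEigenvalue.exists_hasEigenvector h
  refine ⟨f, hf.2, fun x => ?_⟩
  have := congrFun hf.apply_eq_smul x
  simpa [Matrix.toLin'_apply, adjMatrix_mulVec_apply] using this

lemma le_of_mem_adjEigenvalues {k : ℕ} (hk : G.IsRegularOfDegree k) {θ : ℝ}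
    (h : θ ∈ G.adjEigenvalues) : θ ≤ k := by
  obtain ⟨f, hf0, hf⟩ := exists_isEigenfunction h
  obtain ⟨z, hz⟩ := Function.ne_iff.mp hf0
  obtain ⟨x, -, hx⟩ := Finset.exists_max_image Finset.univ (fun x => |f x|) ⟨z, Finset.mem_univ z⟩
  have hpos : 0 < |f x| := (abs_pos.mpr hz).trans_le (hx z (Finset.mem_univ z))
  have h1 : |θ| * |f x| ≤ k * |f x| := by
    rw [← abs_mul, ← hf x]
    refine (Finset.abs_sum_le_sum_abs _ _).trans ?_
    refine (Finset.sum_le_card_nsmul _ _ (|f x|) fun w _ => hx w (Finset.mem_univ w)).trans ?_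
    rw [card_neighborFinset_eq_degree, hk x, nsmul_eq_mul]
  exact (le_abs_self θ).trans (le_of_mul_le_mul_right h1 hpos)

lemma mul_standard_one {k : ℕ} (hk : G.IsRegularOfDegree k) {θ : ℝ} {u : ℕ → ℝ} (hu0 : u 0 = 1)
    {x : V} (hu : G.IsEigenfunction θ (fun y => u (G.dist x y))) : (k : ℝ) * u 1 = θ := by
  have h : ∑ w ∈ G.neighborFinset x, u (G.dist x w) = θ * u (G.dist x x) := hu x
  have h1 : ∀ w ∈ G.neighborFinset x, u (G.dist x w) = u 1 := fun w hw => by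
    rw [mem_neighborFinset] at hw
    rw [dist_eq_one_iff_adj.mpr hw]
  rwa [dist_self, hu0, mul_one, Finset.sum_congr rfl h1, Finset.sum_const,
    card_neighborFinset_eq_degree, hk x, nsmul_eq_mul] at h

namespace IsDistanceRegularWith

lemma c_zero (h : G.IsDistanceRegularWith d a b c) : c 0 = 0 := by
  obtain ⟨y⟩ := h.connected.nonempty
  have := h.card_prev y y
  simpa using this.symm

/-- Neighbours of `x` change the distance to `y` by at most one. The truncated `0 - 1` is harmless
because `c 0` is zero. -/
lemma sum_neighbor_radial (h : G.IsDistanceRegularWith d a b c) (φ : ℕ → ℝ) (y x : V) :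
    ∑ w ∈ G.neighborFinset x, φ (G.dist y w) =
      a (G.dist y x) * φ (G.dist y x) + b (G.dist y x) * φ (G.dist y x + 1) +
        c (G.dist y x) * φ (G.dist y x - 1) := by
  have key : ∀ w ∈ G.neighborFinset x, φ (G.dist y w) =
      (if G.dist y w = G.dist y x then φ (G.dist y x) else 0) +
      (if G.dist y w = G.dist y x + 1 then φ (G.dist y x + 1) else 0) +
      (if G.dist y w + 1 = G.dist y x then φ (G.dist y x - 1) else 0) := by
    intro w hw
    rw [mem_neighborFinset] at hw
    have h1 := h.connected.dist_triangle (u := y) (v := x) (w := w)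
    have h2 := h.connected.dist_triangle (u := y) (v := w) (w := x)
    rw [dist_eq_one_iff_adj.mpr hw] at h1
    rw [dist_eq_one_iff_adj.mpr hw.symm] at h2
    have h3 : G.dist y w = G.dist y x ∨ G.dist y w = G.dist y x + 1 ∨
        G.dist y w + 1 = G.dist y x := by omega
    rcases h3 with h3 | h3 | h3
    · simp [h3]
    · have h4 : ¬ (G.dist y x + 1 + 1 = G.dist y x) := by omega
      simp [h3, h4]
    · have h4 : ¬ (G.dist y w = G.dist y w + 1) := by omega
      have h5 : ¬ (G.dist y w = G.dist y w + 1 + 1) := by omega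
      simp [← h3, h5]
  rw [Finset.sum_congr rfl key, Finset.sum_add_distrib, Finset.sum_add_distrib,
    ← Finset.sum_filter, ← Finset.sum_filter, ← Finset.sum_filter, Finset.sum_const,
    Finset.sum_const, Finset.sum_const, h.card_same, h.card_next, h.card_prev]
  simp

lemma add_add_eq (h : G.IsDistanceRegularWith d a b c) {k : ℕ} (hk : G.IsRegularOfDegree k)
    (y x : V) : a (G.dist y x) + b (G.dist y x) + c (G.dist y x) = k := by
  have := h.sum_neighbor_radial (fun _ => 1) y x
  rw [Finset.sum_const, card_neighborFinset_eq_degree, hk x] at this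
  simp only [nsmul_eq_mul, mul_one] at this
  exact_mod_cast this.symm

/-- Self-adjointness of the adjacency operator, applied to a radial function and an eigenfunction.
-/
lemma sum_radial_mul (h : G.IsDistanceRegularWith d a b c) {θ : ℝ} {g : V → ℝ}
    (hg : G.IsEigenfunction θ g) (φ : ℕ → ℝ) (y : V) :
    ∑ w, (a (G.dist y w) * φ (G.dist y w) + b (G.dist y w) * φ (G.dist y w + 1) +
        c (G.dist y w) * φ (G.dist y w - 1)) * g w = θ * ∑ x, φ (G.dist y x) * g x := by
  simp_rw [← h.sum_neighbor_radial φ y, Finset.mul_sum, Finset.sum_mul]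
  have : ∀ x, θ * (φ (G.dist y x) * g x) = ∑ w ∈ G.neighborFinset x, φ (G.dist y x) * g w := by
    intro x
    rw [← Finset.mul_sum, hg x]; ring
  simp_rw [this]
  exact Finset.sum_comm' (by simp [adj_comm])

lemma sphereSum_recurrence (h : G.IsDistanceRegularWith d a b c) {θ : ℝ} {g : V → ℝ}
    (hg : G.IsEigenfunction θ g) (i : ℕ) (y : V) :
    c (i + 2) * G.sphereSum g (i + 2) y = (θ - a (i + 1)) * G.sphereSum g (i + 1) y -
      b i * G.sphereSum g i y := by
  -- Testing against the indicator of the sphere of radius `i + 1` leaves only the three adjacent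
  -- spheres.
  have := h.sum_radial_mul hg (fun j => if j = i + 1 then 1 else 0) y
  have e1 : ∀ w, (a (G.dist y w) * (if G.dist y w = i + 1 then 1 else 0) +
      b (G.dist y w) * (if G.dist y w + 1 = i + 1 then 1 else 0) +
        c (G.dist y w) * (if G.dist y w - 1 = i + 1 then 1 else 0)) * g w =
      a (i + 1) * (if G.dist y w = i + 1 then g w else 0) +
      b i * (if G.dist y w = i then g w else 0) +
      c (i + 2) * (if G.dist y w = i + 2 then g w else (0 : ℝ)) := by
    intro w
    by_cases h1 : G.dist y w = i + 1
    · simp [h1]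
    by_cases h2 : G.dist y w = i
    · have : ¬ (i - 1 = i + 1) := by omega
      simp [h2, this]
    by_cases h3 : G.dist y w = i + 2
    · simp [h3]
    · have : ¬ (G.dist y w - 1 = i + 1) := by omega
      simp [h1, h2, h3, this]
  simp only [e1, Finset.sum_add_distrib, ← Finset.mul_sum] at this
  simp only [ite_mul, one_mul, zero_mul] at this
  unfold sphereSum
  linarith

lemma sphereSum_zero (h : G.IsDistanceRegularWith d a b c) (g : V → ℝ) (y : V) :
    G.sphereSum g 0 y = g y := by
  unfold sphereSum
  simp [h.connected.dist_eq_zero_iff]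

lemma sphereSum_one {θ : ℝ} {g : V → ℝ} (hg : G.IsEigenfunction θ g) (y : V) :
    G.sphereSum g 1 y = θ * g y := by
  unfold sphereSum
  rw [← hg y, ← Finset.sum_filter]
  congr 1
  ext x
  simp [dist_eq_one_iff_adj]

lemma dist_le (h : G.IsDistanceRegularWith d a b c) (x y : V) : G.dist x y ≤ d := by
  rw [← h.diam_eq]
  have := h.connected.nonempty
  exact dist_le_diam (connected_iff_ediam_ne_top.mp h.connected)

lemma exists_dist_eq (h : G.IsDistanceRegularWith d a b c) {i : ℕ} (hi : i ≤ d) :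
    ∃ x y, G.dist x y = i := by
  have := h.connected.nonempty
  obtain ⟨x, y, hxy⟩ := G.exists_dist_eq_diam
  rw [h.diam_eq] at hxy
  obtain ⟨p, hp⟩ := h.connected.exists_walk_length_eq_dist x y
  refine ⟨x, p.getVert i, ?_⟩
  have h1 : G.dist x (p.getVert i) ≤ i := by
    exact (SimpleGraph.dist_le (p.take i)).trans (by simp)
  have h2 : G.dist (p.getVert i) y ≤ p.length - i := by
    exact (SimpleGraph.dist_le (p.drop i)).trans (by simp)
  have h3 := h.connected.dist_triangle (u := x) (v := p.getVert i) (w := y)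
  omega

lemma c_pos (h : G.IsDistanceRegularWith d a b c) {i : ℕ} (hi : i + 1 ≤ d) : 0 < c (i + 1) := by
  obtain ⟨x, y, hxy⟩ := h.exists_dist_eq hi
  obtain ⟨z, hz, hxz⟩ := exists_adj_dist_eq h.connected hxy
  rw [← hxy, ← h.card_prev, Finset.card_pos]
  exact ⟨z, by simp [hz.symm, hxz, hxy]⟩

lemma b_pos (h : G.IsDistanceRegularWith d a b c) {i : ℕ} (hi : i + 1 ≤ d) : 0 < b i := by
  obtain ⟨x, y, hxy⟩ := h.exists_dist_eq hi
  obtain ⟨z, hz, hxz⟩ := exists_adj_dist_eq h.connected hxy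
  rw [← hxz, ← h.card_next, Finset.card_pos]
  exact ⟨y, by simp [hz, hxz, hxy]⟩

lemma c_one (h : G.IsDistanceRegularWith d a b c) (hd : 1 ≤ d) : c 1 = 1 := by
  obtain ⟨x, y, hxy⟩ := h.exists_dist_eq hd
  have e := h.card_prev x y
  rw [hxy] at e
  rw [← e, Finset.card_eq_one]
  refine ⟨x, ?_⟩
  ext w
  simp only [Finset.mem_filter, mem_neighborFinset, Finset.mem_singleton]
  constructor
  · rintro ⟨_, h2⟩
    exact (h.connected.dist_eq_zero_iff.mp (by omega)).symm
  · rintro rfl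
    exact ⟨(dist_eq_one_iff_adj.mp hxy).symm, by simp⟩

lemma sphereSum_eq_zero (h : G.IsDistanceRegularWith d a b c) (g : V → ℝ) {i : ℕ} (hi : d < i)
    (y : V) : G.sphereSum g i y = 0 := by
  unfold sphereSum
  refine Finset.sum_eq_zero fun x _ => if_neg ?_
  have := h.dist_le y x
  omega

/-- The distance-`i` operator is a polynomial in the adjacency operator, by the three-term
recurrence, so it acts on eigenfunctions by a scalar depending only on θ and `i`. Beyond the
diameter the spheres are empty. -/
lemma exists_sphereSum_eq (h : G.IsDistanceRegularWith d a b c) (θ : ℝ) :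
    ∃ P : ℕ → ℝ, ∀ g, G.IsEigenfunction θ g → ∀ i y, G.sphereSum g i y = P i * g y := by
  have key : ∀ i, ∃ p : ℝ, ∀ g, G.IsEigenfunction θ g → ∀ y, G.sphereSum g i y = p * g y := by
    intro i
    induction i using Nat.twoStepInduction with
    | zero => exact ⟨1, fun g _ y => by rw [h.sphereSum_zero, one_mul]⟩
    | one => exact ⟨θ, fun g hg y => sphereSum_one hg y⟩
    | more i ih1 ih2 =>
      obtain ⟨p1, h1⟩ := ih1
      obtain ⟨p2, h2⟩ := ih2
      rcases le_or_gt (i + 2) d with hi | hi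
      · have hc : (c (i + 2) : ℝ) ≠ 0 := by exact_mod_cast (h.c_pos hi).ne'
        refine ⟨((θ - a (i + 1)) * p2 - b i * p1) / c (i + 2), fun g hg y => ?_⟩
        have := h.sphereSum_recurrence hg i y
        rw [h1 g hg, h2 g hg] at this
        field_simp
        linarith
      · exact ⟨0, fun g _ y => by rw [h.sphereSum_eq_zero g hi, zero_mul]⟩
  choose P hP using key
  exact ⟨P, fun g hg i y => hP i g hg y⟩

/-- The standard sequence of an eigenvalue: its radial extensions are eigenfunctions. -/
lemma exists_standard_sequence (h : G.IsDistanceRegularWith d a b c) {k : ℕ}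
    (hk : G.IsRegularOfDegree k) {θ : ℝ} (hθ : θ ∈ G.adjEigenvalues) :
    ∃ u : ℕ → ℝ, u 0 = 1 ∧ ∀ y, G.IsEigenfunction θ (fun x => u (G.dist y x)) := by
  obtain ⟨f, hf0, hf⟩ := exists_isEigenfunction hθ
  obtain ⟨z, hz⟩ := Function.ne_iff.mp hf0
  replace hz : f z ≠ 0 := hz
  obtain ⟨P, hP⟩ := h.exists_sphereSum_eq θ
  obtain ⟨K, hK⟩ := h.exists_sphereSum_eq (k : ℝ)
  -- The constant function has eigenvalue `k`, and its scalars `K i` are the sphere sizes. The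
  -- standard sequence is the spherical average `P i / K i`.
  have hone : G.IsEigenfunction (k : ℝ) (fun _ : V => (1 : ℝ)) := by
    intro x
    simp [hk x]
  have hP0 : P 0 = 1 := by
    have := hP f hf 0 z
    rw [h.sphereSum_zero] at this
    exact (mul_right_cancel₀ hz (by simpa using this)).symm
  have hP1 : P 1 = θ := by
    have := hP f hf 1 z
    rw [sphereSum_one hf] at this
    exact (mul_right_cancel₀ hz this).symm
  have hPr : ∀ i, c (i + 2) * P (i + 2) = (θ - a (i + 1)) * P (i + 1) - b i * P i := by
    intro i
    have := h.sphereSum_recurrence hf i z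
    rw [hP f hf, hP f hf, hP f hf] at this
    exact mul_right_cancel₀ hz (by linear_combination this)
  have hK' : ∀ i y, G.sphereSum (fun _ => 1) i y = K i := fun i y => by
    rw [hK _ hone, mul_one]
  have hK0 : K 0 = 1 := by rw [← hK' 0 z, h.sphereSum_zero]
  have hK1 : K 1 = k := by rw [← hK' 1 z, sphereSum_one hone, mul_one]
  have hKr : ∀ i, c (i + 2) * K (i + 2) = (k - a (i + 1)) * K (i + 1) - b i * K i := by
    intro i
    have := h.sphereSum_recurrence hone i z
    rwa [hK', hK', hK'] at this
  have hKpos : ∀ i ≤ d, 0 < K i := by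
    intro i hi
    obtain ⟨x, y, hxy⟩ := h.exists_dist_eq hi
    rw [← hK' i x]
    unfold sphereSum
    refine Finset.sum_pos' (fun w _ => by split_ifs <;> norm_num) ⟨y, Finset.mem_univ y, ?_⟩
    simp [hxy]
  have hsum : ∀ i ≤ d, (a i : ℝ) + b i + c i = k := by
    intro i hi
    obtain ⟨x, y, hxy⟩ := h.exists_dist_eq hi
    have := h.add_add_eq hk x y
    rw [hxy] at this
    exact_mod_cast this
  have ha0 : a 0 = 0 := by
    have := h.card_same z z
    rw [dist_self] at this
    rw [← this, Finset.card_eq_zero, Finset.filter_eq_empty_iff]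
    intro w hw h0
    rw [h.connected.dist_eq_zero_iff] at h0
    subst h0
    simp at hw
  have hc1 : c 1 * P 1 = θ * P 0 ∧ c 1 * K 1 = k * K 0 := by
    rcases Nat.eq_zero_or_pos d with hd | hd
    · have hs1 := h.sphereSum_eq_zero f (i := 1) (by omega) z
      have hs2 := h.sphereSum_eq_zero (fun _ => 1) (i := 1) (by omega) z
      rw [hP f hf] at hs1
      rw [hK', hK1] at hs2
      have hP1' : P 1 = 0 := by simpa [hz] using hs1
      rw [hP1'] at hP1
      simp [hP1', hP0, ← hP1, hK1, hs2]
    · have := h.c_one hd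
      simp [this, hP0, hP1, hK0, hK1]
  -- The number of edges between consecutive spheres, counted from either side. It turns the
  -- recurrence for `P` into the one for `P / K`.
  have hbal : ∀ i < d, c (i + 1) * K (i + 1) = b i * K i := by
    intro i
    induction i with
    | zero =>
      intro _
      have := hsum 0 (Nat.zero_le _)
      rw [ha0, h.c_zero] at this
      rw [hc1.2, ← this]; simp
    | succ i ih =>
      intro hi
      have h1 := ih (by omega)
      have h2 := hsum (i + 1) (by omega)
      rw [hKr, ← h2]
      linear_combination h1
  refine ⟨fun i => P i / K i, by simp [hP0, hK0], fun y x => ?_⟩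
  change ∑ w ∈ _, (fun i => P i / K i) (G.dist y w) = θ * (P (G.dist y x) / K (G.dist y x))
  rw [h.sum_neighbor_radial (fun i => P i / K i) y x]
  obtain ⟨i, hi⟩ : ∃ i, G.dist y x = i := ⟨_, rfl⟩
  have hid : i ≤ d := hi ▸ h.dist_le y x
  rw [hi]
  -- At `i = d` both sides vanish, because `P (d + 1) = 0`.
  have hup : b i * (P (i + 1) / K (i + 1)) = c (i + 1) * P (i + 1) / K i := by
    rcases hid.lt_or_eq with hlt | heq
    · have h1 := hKpos i hid
      have h2 := hKpos (i + 1) hlt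
      have h3 := hbal i hlt
      field_simp
      linear_combination -P (i + 1) * h3
    · have h1 : P (i + 1) = 0 := by
        have hs := h.sphereSum_eq_zero f (i := i + 1) (by omega) z
        rw [hP f hf] at hs
        simpa [hz] using hs
      simp [h1]
  rcases i with _ | i
  · rw [hup, h.c_zero, ha0, hc1.1, hP0, hK0]; simp
  · have h1 := hKpos (i + 1) hid
    have h2 := hKpos i (by omega)
    have h3 := hbal i (by omega)
    have hdown : c (i + 1) * (P i / K i) = b i * P i / K (i + 1) := by
      field_simp
      linear_combination P i * h3
    rw [hup, Nat.add_sub_cancel, hdown]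
    have h4 := hPr i
    field_simp
    linear_combination h4

/-- Splitting the sum into spheres around `x` leaves sphere sums of the eigenfunction radial about
`y`. Hence the Gram matrix of the radial eigenfunctions depends only on distance. -/
lemma exists_sum_standard_mul (h : G.IsDistanceRegularWith d a b c) {θ : ℝ} {u : ℕ → ℝ}
    (hu0 : u 0 = 1) (hu : ∀ y, G.IsEigenfunction θ (fun x => u (G.dist y x))) :
    ∃ κ : ℝ, 0 < κ ∧
      ∀ x y, ∑ z, u (G.dist x z) * u (G.dist y z) = κ * u (G.dist x y) := by
  obtain ⟨P, hP⟩ := h.exists_sphereSum_eq θ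
  have key : ∀ x y, ∑ z, u (G.dist x z) * u (G.dist y z) =
      (∑ i ∈ Finset.range (d + 1), u i * P i) * u (G.dist x y) := by
    intro x y
    rw [dist_comm, Finset.sum_mul]
    simp_rw [mul_assoc, ← hP _ (hu y) _ x, sphereSum, Finset.mul_sum]
    rw [Finset.sum_comm]
    refine Finset.sum_congr rfl fun z _ => ?_
    rw [Finset.sum_eq_single (G.dist x z)]
    · simp
    · intro i _ hi
      rw [if_neg (Ne.symm hi), mul_zero]
    · intro hz
      exact absurd (Finset.mem_range.mpr (Nat.lt_succ_of_le (h.dist_le x z))) hz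
  refine ⟨_, ?_, key⟩
  obtain ⟨x⟩ := h.connected.nonempty
  have := key x x
  rw [dist_self, hu0, mul_one] at this
  rw [← this]
  refine Finset.sum_pos' (fun z _ => mul_self_nonneg _) ⟨x, Finset.mem_univ x, ?_⟩
  simp [hu0]

end IsDistanceRegularWith

end Representation

/-! ### Approximate parallelograms and their rigidity. -/

section Quadrangles

variable {V : Type*}

/-- `x, p, y, z` is an induced quadrangle. -/
structure IsQuad (G : SimpleGraph V) (x p y z : V) : Prop where
  xp : G.Adj x p
  py : G.Adj p y
  yz : G.Adj y z
  zx : G.Adj z x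
  ne₁ : x ≠ y
  ne₂ : p ≠ z
  nadj₁ : ¬ G.Adj x y
  nadj₂ : ¬ G.Adj p z

namespace IsQuad

variable {G : SimpleGraph V} {x p y z : V}

lemma rotate (h : G.IsQuad x p y z) : G.IsQuad p y z x :=
  ⟨h.py, h.yz, h.zx, h.xp, h.ne₂, h.ne₁.symm, h.nadj₂, fun h' => h.nadj₁ h'.symm⟩

lemma flip (h : G.IsQuad x p y z) : G.IsQuad x z y p :=
  ⟨h.zx.symm, h.yz.symm, h.py.symm, h.xp.symm, h.ne₁, h.ne₂.symm, h.nadj₁,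
    fun h' => h.nadj₂ h'.symm⟩

lemma swap (h : G.IsQuad x p y z) : G.IsQuad p x z y := h.rotate.rotate.rotate.flip.rotate.rotate

end IsQuad

/-- A representation of a diamond-free graph, in which any two vertices at distance two lie in a
quadrangle, such that the distance between the images of `x` and `y` is constant over adjacent
pairs and over pairs at distance two, every image is proportional to the sum of the images of
its neighbours, and quadrangles are mapped to approximate parallelograms. -/
structure IsAlmostParallelogramRep [Fintype V] [DecidableEq V] (G : SimpleGraph V)
    [DecidableRel G.Adj] {E : Type*} [NormedAddCommGroup E] [InnerProductSpace ℝ E] (k l : ℕ)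
    (θ α β ε : ℝ) (H : V → E) : Prop where
  diamondFree : ∀ {x y z w}, G.Adj x y → G.Adj x z → G.Adj y z → G.Adj x w → G.Adj y w →
    z ≠ w → G.Adj z w
  exists_common : ∀ {p x z}, G.Adj p x → G.Adj x z → p ≠ z → ¬ G.Adj p z →
    ∃ y, y ≠ x ∧ G.Adj p y ∧ G.Adj y z
  regular : G.IsRegularOfDegree k
  card_common : ∀ {x y}, G.Adj x y → ((G.neighborFinset x).filter (fun w => G.Adj w y)).card = l
  norm_adj : ∀ {x y}, G.Adj x y → ‖H x - H y‖ ^ 2 = α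
  norm_two : ∀ {x z y}, G.Adj x z → G.Adj z y → x ≠ y → ¬ G.Adj x y → ‖H x - H y‖ ^ 2 = β
  sum_neighbor : ∀ x, ∑ w ∈ G.neighborFinset x, H w = θ • H x
  pos : 0 < α
  defect : 4 * α - 2 * β ≤ 2 * ε * α
  small : 192 * ε ≤ 1
  gap : (k : ℝ) - 2 * (l + 1) < θ + 2

section OffLines

variable [Fintype V] [DecidableEq V] {G : SimpleGraph V} [DecidableRel G.Adj] {x p y z w : V}

/-- The neighbours of `x` that lie on neither of the lines through `x, p` and through `x, z`. -/
def offLines (G : SimpleGraph V) [DecidableRel G.Adj] (x p z : V) : Finset V :=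
  (G.neighborFinset x).filter fun w => w ≠ p ∧ w ≠ z ∧ ¬ G.Adj w p ∧ ¬ G.Adj w z

lemma mem_offLines : w ∈ offLines G x p z ↔
    G.Adj x w ∧ w ≠ p ∧ w ≠ z ∧ ¬ G.Adj w p ∧ ¬ G.Adj w z := by
  simp [offLines]

lemma offLines_comm : offLines G x p z = offLines G x z p := by
  ext w
  simp only [mem_offLines]
  tauto

end OffLines

section Norms

variable {E : Type*} [NormedAddCommGroup E] [InnerProductSpace ℝ E]

lemma norm_sq_sub_add_sub (a b c d : E) : ‖a - b + c - d‖ ^ 2 =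
    ‖a - b‖ ^ 2 + ‖b - c‖ ^ 2 + ‖c - d‖ ^ 2 + ‖d - a‖ ^ 2 - ‖a - c‖ ^ 2 - ‖b - d‖ ^ 2 := by
  simp only [← real_inner_self_eq_norm_sq, inner_sub_left, inner_sub_right, inner_add_left,
    inner_add_right]
  simp only [real_inner_comm]
  rw [real_inner_comm b a, real_inner_comm c a, real_inner_comm d a, real_inner_comm c b,
    real_inner_comm d b, real_inner_comm d c]
  ring

lemma norm_add_sq_le (a b : E) {t : ℝ} (ht : 0 < t) :
    ‖a + b‖ ^ 2 ≤ (1 + t) * ‖a‖ ^ 2 + (1 + t⁻¹) * ‖b‖ ^ 2 := by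
  have h1 : ‖a + b‖ ^ 2 ≤ (‖a‖ + ‖b‖) ^ 2 := by
    gcongr
    exact norm_add_le a b
  have h2 : 0 ≤ t⁻¹ * (t * ‖a‖ - ‖b‖) ^ 2 := by positivity
  have h3 : t⁻¹ * (t * ‖a‖ - ‖b‖) ^ 2 = t * ‖a‖ ^ 2 - 2 * ‖a‖ * ‖b‖ + t⁻¹ * ‖b‖ ^ 2 := by
    field_simp
    ring
  nlinarith

end Norms

namespace IsAlmostParallelogramRep

variable [Fintype V] [DecidableEq V] {G : SimpleGraph V} [DecidableRel G.Adj] {E : Type*}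
  [NormedAddCommGroup E] [InnerProductSpace ℝ E] {k l : ℕ} {θ α β ε : ℝ} {H : V → E}
  {x p y z w : V}

lemma norm_defect (R : G.IsAlmostParallelogramRep k l θ α β ε H) (h : G.IsQuad x p y z) :
    ‖H x - H p + H y - H z‖ ^ 2 = 4 * α - 2 * β := by
  rw [norm_sq_sub_add_sub, R.norm_adj h.xp, R.norm_adj h.py, R.norm_adj h.yz, R.norm_adj h.zx,
    R.norm_two h.xp h.py h.ne₁ h.nadj₁, R.norm_two h.py h.yz h.ne₂ h.nadj₂]
  ring

lemma exists_quad (R : G.IsAlmostParallelogramRep k l θ α β ε H) (h₁ : G.Adj x p)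
    (h₂ : G.Adj x z) (hne : p ≠ z) (hn : ¬ G.Adj p z) : ∃ y, G.IsQuad x p y z := by
  obtain ⟨y, hy, h₃, h₄⟩ := R.exists_common h₁.symm h₂ hne hn
  exact ⟨y, h₁, h₃, h₄, h₂.symm, hy.symm, hne,
    fun h => hn (R.diamondFree h h₁ h₃.symm h₂ h₄ hne), hn⟩

lemma le_beta (R : G.IsAlmostParallelogramRep k l θ α β ε H) : (2 - ε) * α ≤ β := by
  linarith [R.defect]

lemma beta_pos (R : G.IsAlmostParallelogramRep k l θ α β ε H) : α < β := by
  have := R.le_beta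
  nlinarith [R.pos, R.small]

lemma defect_lt (R : G.IsAlmostParallelogramRep k l θ α β ε H) :
    96 * (4 * α - 2 * β) ≤ α := by
  nlinarith [R.pos, R.small, R.defect]

/-- Two distinct fourth vertices would be at distance two by diamond-freeness, so β apart, whereas
their images differ by two short defects. -/
lemma quad_unique (R : G.IsAlmostParallelogramRep k l θ α β ε H) {y' : V}
    (h : G.IsQuad x p y z) (h' : G.IsQuad x p y' z) : y = y' := by
  by_contra hne
  have hn : ¬ G.Adj y y' := fun hyy =>
    h.nadj₂ (R.diamondFree hyy h.py.symm h'.py.symm h.yz h'.yz h.ne₂)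
  have h1 := R.norm_two h.py.symm h'.py hne hn
  have h2 := norm_add_sq_le (H x - H p + H y - H z) (-(H x - H p + H y' - H z)) one_pos
  rw [norm_neg, R.norm_defect h, R.norm_defect h', show (H x - H p + H y - H z) +
    -(H x - H p + H y' - H z) = H y - H y' by abel, h1] at h2
  linarith [R.defect_lt, R.beta_pos, R.pos]

/-- `H y - H y'` differs from `H p - H p'` only by two defects, so its squared length is too close
to α to equal β. -/
lemma transport_adj (R : G.IsAlmostParallelogramRep k l θ α β ε H) {p' y' : V}
    (h : G.IsQuad x p y z) (h' : G.IsQuad x p' y' z) (hp : G.Adj p p') : G.Adj y y' := by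
  by_contra hn
  have hne : y ≠ y' := by
    rintro rfl
    exact h.nadj₁ (R.diamondFree hp h.xp.symm h'.xp.symm h.py h'.py h.ne₁)
  have h1 := R.norm_two h.yz h'.yz.symm hne hn
  have h2 := norm_add_sq_le (H x - H p + H y - H z) (-(H x - H p' + H y' - H z)) one_pos
  -- With `t = 1 / 2` the main term gets the factor 3/2, safely below β/α, and the error only the
  -- factor 3.
  have h3 := norm_add_sq_le (H p - H p')
    ((H x - H p + H y - H z) + -(H x - H p' + H y' - H z)) (t := 1 / 2) (by norm_num)
  rw [norm_neg, R.norm_defect h, R.norm_defect h'] at h2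
  rw [show H p - H p' + ((H x - H p + H y - H z) + -(H x - H p' + H y' - H z)) =
    H y - H y' by abel, h1, R.norm_adj hp] at h3
  norm_num at h2 h3
  linarith [R.defect_lt, R.beta_pos, R.pos, R.defect]

lemma eq_of_norm_lt (R : G.IsAlmostParallelogramRep k l θ α β ε H) {y' : V}
    (h : G.Adj p y) (h' : G.Adj p y') (hlt : ‖H y - H y'‖ ^ 2 < α) : y = y' := by
  by_contra hne
  by_cases hn : G.Adj y y'
  · exact hlt.ne (R.norm_adj hn)
  · have := R.norm_two h.symm h' hne hn
    linarith [R.beta_pos]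

lemma not_adj_opposite (R : G.IsAlmostParallelogramRep k l θ α β ε H) (h : G.IsQuad x p y z)
    (hw : w ∈ offLines G x p z) : ¬ G.Adj w y := by
  rw [mem_offLines] at hw
  intro hwy
  have h1 : G.IsQuad p x w y := ⟨h.xp.symm, hw.1, hwy, h.py.symm, hw.2.1.symm, h.ne₁,
    fun h' => hw.2.2.2.1 h'.symm, h.nadj₁⟩
  exact hw.2.2.1 (R.quad_unique h1 h.swap)

lemma transport_mem (R : G.IsAlmostParallelogramRep k l θ α β ε H) (h : G.IsQuad x p y z)
    (hw : w ∈ offLines G x p z) {w' : V} (hq : G.IsQuad x w w' p) : w' ∈ offLines G p x y := by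
  have hwy := R.not_adj_opposite h hw
  rw [mem_offLines] at hw ⊢
  refine ⟨hq.yz.symm, hq.ne₁.symm, ?_, fun h' => hq.nadj₁ h'.symm, ?_⟩
  · rintro rfl
    exact hwy hq.py
  · intro h'
    exact hw.2.2.2.2 (R.transport_adj hq.rotate.rotate.rotate.flip h.rotate h')

/-- Transporting the edge from `x` to `w` around a quadrangle closes up. Completing the cube from
`w` instead yields a vertex `y'` in place of `y`; their images differ by a combination of four
defects, of squared length at most 16(4α - 2β) < α, so they coincide. -/
lemma cube (R : G.IsAlmostParallelogramRep k l θ α β ε H) (h : G.IsQuad x p y z)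
    (hw : w ∈ offLines G x p z) {wp wz wy : V} (hp : G.IsQuad x w wp p)
    (hz : G.IsQuad x w wz z) (hy : G.IsQuad p wp wy y) : G.IsQuad w wp wy wz := by
  have hwy := R.not_adj_opposite h hw
  have hwz := R.transport_mem h.flip (by rwa [offLines_comm]) hz
  have hwp := R.transport_mem h hw hp
  rw [mem_offLines] at hw hwz hwp
  have hpwz : ¬ G.Adj p wz := fun h' => hwz.2.2.1
    (R.quad_unique ⟨h.xp, h', hz.yz, h.zx, hz.ne₁, h.ne₂, hz.nadj₁, h.nadj₂⟩ h)
  have h1 : wp ≠ wz := by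
    rintro rfl
    exact hpwz hwp.1
  have h2 : ¬ G.Adj wp wz := fun h' =>
    h.nadj₂ (R.transport_adj hp.rotate hz.rotate h')
  obtain ⟨v, hv⟩ := R.exists_quad hp.py hz.py h1 h2
  have h3 : p ≠ v := by
    rintro rfl
    exact hpwz hv.yz
  have h4 : ¬ G.Adj p v := fun h' => hz.nadj₁
    (R.transport_adj hp.rotate.rotate hv.rotate h')
  obtain ⟨y', hy'⟩ := R.exists_quad hp.yz hv.py h3 h4
  have h5 : ‖H y - H y'‖ ^ 2 < α := by
    have e1 := norm_add_sq_le (H x - H p + H y - H z) (-(H wp - H p + H y' - H v)) one_pos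
    have e2 := norm_add_sq_le (-(H w - H wp + H v - H wz)) (-(H x - H w + H wz - H z)) one_pos
    have e3 := norm_add_sq_le ((H x - H p + H y - H z) + -(H wp - H p + H y' - H v))
      (-(H w - H wp + H v - H wz) + -(H x - H w + H wz - H z)) one_pos
    rw [norm_neg, R.norm_defect h, R.norm_defect hy'] at e1
    rw [norm_neg, norm_neg, R.norm_defect hv, R.norm_defect hz] at e2
    rw [show ((H x - H p + H y - H z) + -(H wp - H p + H y' - H v)) +
      (-(H w - H wp + H v - H wz) + -(H x - H w + H wz - H z)) = H y - H y' by abel] at e3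
    norm_num at e1 e2 e3
    linarith [R.defect_lt, R.pos]
  obtain rfl := R.eq_of_norm_lt h.py hy'.py h5
  obtain rfl := R.quad_unique hy hy'.swap
  exact hv

/-- The vertex opposite to `x` in the quadrangle spanned by the edges `x, p` and `x, z`. -/
noncomputable def opposite (G : SimpleGraph V) (x p z : V) : V :=
  open Classical in if h : ∃ y, G.IsQuad x p y z then h.choose else x

lemma isQuad_opposite (R : G.IsAlmostParallelogramRep k l θ α β ε H) (h₁ : G.Adj x p)
    (h₂ : G.Adj x z) (hne : p ≠ z) (hn : ¬ G.Adj p z) : G.IsQuad x p (opposite G x p z) z := by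
  have h := R.exists_quad h₁ h₂ hne hn
  rw [opposite, dif_pos h]
  exact h.choose_spec

lemma opposite_eq (R : G.IsAlmostParallelogramRep k l θ α β ε H) (h : G.IsQuad x p y z) :
    opposite G x p z = y :=
  R.quad_unique (R.isQuad_opposite h.xp h.zx.symm h.ne₂ h.nadj₂) h

lemma isQuad_of_mem_offLines (R : G.IsAlmostParallelogramRep k l θ α β ε H)
    (h : G.Adj x p) (hw : w ∈ offLines G x p z) : G.IsQuad x w (opposite G x w p) p := by
  rw [mem_offLines] at hw
  exact R.isQuad_opposite hw.1 h hw.2.1 hw.2.2.2.1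

lemma sum_offLines (R : G.IsAlmostParallelogramRep k l θ α β ε H) (h : G.IsQuad x p y z)
    {M : Type*} [AddCommMonoid M] (f : V → M) :
    ∑ w ∈ offLines G p x y, f w = ∑ w ∈ offLines G x p z, f (opposite G x w p) := by
  refine Finset.sum_nbij' (fun w => opposite G p w x) (fun w => opposite G x w p)
    (fun w hw => R.transport_mem h.swap hw (R.isQuad_of_mem_offLines h.xp.symm hw))
    (fun w hw => R.transport_mem h hw (R.isQuad_of_mem_offLines h.xp hw)) ?_ ?_ ?_
  · intro w hw
    have := R.isQuad_of_mem_offLines h.xp.symm hw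
    exact R.opposite_eq (this.rotate.rotate.rotate.flip)
  · intro w hw
    have := R.isQuad_of_mem_offLines h.xp hw
    exact R.opposite_eq (this.rotate.rotate.rotate.flip)
  · intro w hw
    have := R.isQuad_of_mem_offLines h.xp.symm hw
    rw [R.opposite_eq (this.rotate.rotate.rotate.flip)]

/-- Diamond-freeness makes the two lines through `x` disjoint away from `x`, so the neighbours split
into these lines and the rest. -/
lemma sum_neighbor_eq (R : G.IsAlmostParallelogramRep k l θ α β ε H) (h₁ : G.Adj x p)
    (h₂ : G.Adj x z) (hne : p ≠ z) (hn : ¬ G.Adj p z) {M : Type*} [AddCommMonoid M] (f : V → M) :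
    ∑ w ∈ G.neighborFinset x, f w = ∑ w ∈ offLines G x p z, f w +
      (f p + ∑ w ∈ (G.neighborFinset x).filter (fun w => G.Adj w p), f w) +
      (f z + ∑ w ∈ (G.neighborFinset x).filter (fun w => G.Adj w z), f w) := by
  have key : ∀ w ∈ G.neighborFinset x, f w =
      (if w ≠ p ∧ w ≠ z ∧ ¬ G.Adj w p ∧ ¬ G.Adj w z then f w else 0) +
      ((if w = p then f w else 0) + (if G.Adj w p then f w else 0)) +
      ((if w = z then f w else 0) + (if G.Adj w z then f w else 0)) := by
    intro w hw
    rw [mem_neighborFinset] at hw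
    have h3 : ¬ (G.Adj w p ∧ G.Adj w z) := fun h' =>
      hn (R.diamondFree hw h₁ h'.1 h₂ h'.2 hne)
    by_cases e1 : w = p
    · subst e1
      simp [hne, hn]
    by_cases e2 : w = z
    · subst e2
      have h4 : ¬ G.Adj w p := fun h' => hn h'.symm
      simp [hne.symm, h4]
    by_cases e3 : G.Adj w p
    · have e4 : ¬ G.Adj w z := fun h' => h3 ⟨e3, h'⟩
      simp [e1, e2, e3, e4]
    · by_cases e4 : G.Adj w z <;> simp [e1, e2, e3, e4]
  rw [Finset.sum_congr rfl key]
  simp only [Finset.sum_add_distrib, Finset.sum_ite_eq', mem_neighborFinset, h₁, h₂, if_true,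
    ← Finset.sum_filter]
  rfl

lemma card_offLines (R : G.IsAlmostParallelogramRep k l θ α β ε H) (h₁ : G.Adj x p)
    (h₂ : G.Adj x z) (hne : p ≠ z) (hn : ¬ G.Adj p z) :
    k = (offLines G x p z).card + 2 * (l + 1) := by
  have := R.sum_neighbor_eq h₁ h₂ hne hn (fun _ => 1)
  simp only [Finset.sum_const, smul_eq_mul, mul_one, R.card_common h₁, R.card_common h₂,
    card_neighborFinset_eq_degree, R.regular x] at this
  omega

lemma filter_neighbor_comm : (G.neighborFinset x).filter (fun w => G.Adj w p) =
    (G.neighborFinset p).filter (fun w => G.Adj w x) := by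
  ext w
  simp only [Finset.mem_filter, mem_neighborFinset, G.adj_comm w]
  tauto

/-- The eigenvalue equation is summed with alternating signs over the four corners. The common
neighbours on each side of the quadrangle cancel, the corners contribute minus twice the defect, and
the remaining neighbours group into transported quadrangles. -/
lemma smul_defect (R : G.IsAlmostParallelogramRep k l θ α β ε H) (h : G.IsQuad x p y z) :
    (θ + 2) • (H x - H p + H y - H z) = ∑ w ∈ offLines G x p z,
      (H w - H (opposite G x w p) + H (opposite G p (opposite G x w p) y) -
        H (opposite G x w z)) := by
  have s1 := R.sum_neighbor_eq h.xp h.zx.symm h.ne₂ h.nadj₂ H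
  have s2 := R.sum_neighbor_eq h.xp.symm h.py h.ne₁ h.nadj₁ H
  have s3 := R.sum_neighbor_eq h.py.symm h.yz h.ne₂ h.nadj₂ H
  have s4 := R.sum_neighbor_eq h.zx h.yz.symm h.ne₁ h.nadj₁ H
  have t2 := R.sum_offLines h H
  have t3 : ∑ w ∈ offLines G y p z, H w = ∑ w ∈ offLines G x p z,
      H (opposite G p (opposite G x w p) y) := by
    rw [R.sum_offLines h.rotate H, offLines_comm (z := x), R.sum_offLines h]
  have t4 := R.sum_offLines h.flip H
  rw [offLines_comm (p := z)] at t4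
  rw [t2] at s2
  rw [t3] at s3
  rw [t4] at s4
  rw [R.sum_neighbor] at s1 s2 s3 s4
  rw [filter_neighbor_comm (x := p) (p := x)] at s2
  rw [filter_neighbor_comm (x := y) (p := p)] at s3
  rw [filter_neighbor_comm (x := z) (p := x), filter_neighbor_comm (x := z) (p := y)] at s4
  rw [Finset.sum_sub_distrib, Finset.sum_add_distrib, Finset.sum_sub_distrib, add_smul, smul_sub,
    smul_add, smul_sub, s1, s2, s3, s4, two_smul]
  abel

/-- Quadrangles are mapped to parallelograms. -/
lemma add_eq_add (R : G.IsAlmostParallelogramRep k l θ α β ε H) (h : G.IsQuad x p y z) :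
    H x + H y = H p + H z := by
  have hn : ∀ {x p y z}, G.IsQuad x p y z →
      ‖H x - H p + H y - H z‖ = √(4 * α - 2 * β) := by
    intro x p y z h
    rw [← R.norm_defect h, Real.sqrt_sq (norm_nonneg _)]
  have h1 : ‖(θ + 2) • (H x - H p + H y - H z)‖ ≤
      (offLines G x p z).card * √(4 * α - 2 * β) := by
    rw [R.smul_defect h, ← nsmul_eq_mul]
    refine (norm_sum_le _ _).trans (Finset.sum_le_card_nsmul _ _ _ fun w hw => ?_)
    have e1 := R.isQuad_of_mem_offLines h.xp hw
    have e2 := R.isQuad_of_mem_offLines h.zx.symm (w := w) (z := p)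
      (by rwa [offLines_comm])
    have e3 := R.transport_mem h hw e1
    rw [offLines_comm] at e3
    exact (hn (R.cube h hw e1 e2 (R.isQuad_of_mem_offLines h.py e3))).le
  have h2 := R.card_offLines h.xp h.zx.symm h.ne₂ h.nadj₂
  -- The number of transported quadrangles is less than θ + 2, and they all share the defect length
  -- `√(4 * α - 2 * β)`, so a nonzero length is contradictory.
  have h3 : (k : ℝ) = (offLines G x p z).card + 2 * (l + 1) := by exact_mod_cast h2
  have h4 := R.gap
  have h5 : ((offLines G x p z).card : ℝ) < θ + 2 := by linarith
  have h6 : (0 : ℝ) ≤ (offLines G x p z).card := Nat.cast_nonneg _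
  rw [norm_smul, hn h, Real.norm_of_nonneg (by linarith)] at h1
  have h7 : √(4 * α - 2 * β) = 0 := by
    by_contra h8
    have : 0 < √(4 * α - 2 * β) := lt_of_le_of_ne (Real.sqrt_nonneg _) (Ne.symm h8)
    nlinarith
  have h8 := hn h
  rw [h7, norm_eq_zero] at h8
  rw [← sub_eq_zero, ← h8]
  abel

lemma beta_eq (R : G.IsAlmostParallelogramRep k l θ α β ε H) (h : G.IsQuad x p y z) :
    β = 2 * α := by
  have h1 := R.norm_defect h
  rw [show H x - H p + H y - H z = (H x + H y) - (H p + H z) by abel, R.add_eq_add h, sub_self,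
    norm_zero] at h1
  linarith

end IsAlmostParallelogramRep

end Quadrangles

/-! ### Coverings of Hamming graphs. -/

section Coordinates

open Function

lemma hammingDist_update {m s : ℕ} (o w : Fin m → Fin s) (i : Fin m) (a : Fin s) :
    hammingDist o (update w i a) + (if o i ≠ w i then 1 else 0) =
      hammingDist o w + (if o i ≠ a then 1 else 0) := by
  simp only [hammingDist, Finset.card_filter]
  rw [← Finset.add_sum_erase _ _ (Finset.mem_univ i),
    ← Finset.add_sum_erase (a := i) _ (fun j => if o j ≠ w j then 1 else 0) (Finset.mem_univ i)]
  have : ∑ j ∈ Finset.univ.erase i, (if o j ≠ update w i a j then 1 else 0) =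
      ∑ j ∈ Finset.univ.erase i, (if o j ≠ w j then 1 else 0) := by
    refine Finset.sum_congr rfl fun j hj => ?_
    rw [update_of_ne (Finset.ne_of_mem_erase hj)]
  rw [this, update_self]
  omega

lemma hammingDist_self_update {m s : ℕ} (w : Fin m → Fin s) (i : Fin m) {a : Fin s}
    (ha : a ≠ w i) : hammingDist w (update w i a) = 1 := by
  have := hammingDist_update w w i a
  simpa [ha.symm] using this

variable {V : Type*}

/-- A map onto a Hamming graph that is a bijection on neighbourhoods and along which triangles and
quadrangles can be lifted. -/
structure IsHammingCovering (G : SimpleGraph V) {m s : ℕ} (Φ : V → Fin m → Fin s) : Prop where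
  exists_update : ∀ {x y}, G.Adj x y → ∃ i a, a ≠ Φ x i ∧ Φ y = update (Φ x) i a
  exists_adj : ∀ x i a, a ≠ Φ x i → ∃ y, G.Adj x y ∧ Φ y = update (Φ x) i a
  eq_of_eq : ∀ {x y z}, G.Adj x y → G.Adj x z → Φ y = Φ z → y = z
  adj_of_update : ∀ {x y z i a}, G.Adj x y → G.Adj x z → a ≠ Φ y i → Φ z = update (Φ y) i a →
    G.Adj y z
  quad : ∀ {x y z i j a b}, G.Adj x y → G.Adj x z → i ≠ j → a ≠ Φ x i → b ≠ Φ x j →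
    Φ y = update (Φ x) i a → Φ z = update (Φ x) j b →
      ∃ w, G.Adj y w ∧ G.Adj w z ∧ Φ w = update (update (Φ x) i a) j b

namespace IsHammingCovering

variable {G : SimpleGraph V} {m s : ℕ} {Φ : V → Fin m → Fin s}

/-- The second clause, that a step decreasing Hamming distance also decreases graph distance, is
needed for the induction on the first. -/
lemma dist_aux (hΦ : G.IsHammingCovering Φ) (hG : G.Connected) (x : V) (h : ℕ) :
    ∀ y, G.dist x y = h → hammingDist (Φ x) (Φ y) = h ∧
      ∀ z, G.Adj y z → hammingDist (Φ x) (Φ z) + 1 = h → G.dist x z + 1 = h := by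
  induction h with
  | zero =>
    intro y hy
    obtain rfl := hG.dist_eq_zero_iff.mp hy
    simp
  | succ h ih =>
    intro y hy
    have step : ∀ {u v}, G.Adj u v → G.dist x v ≤ G.dist x u + 1 := fun {u v} huv => by
      have := hG.dist_triangle (u := x) (v := u) (w := v)
      rwa [dist_eq_one_iff_adj.mpr huv] at this
    have main : ∀ u, G.Adj u y → G.dist x u = h →
        hammingDist (Φ x) (Φ u) = h ∧ hammingDist (Φ x) (Φ y) = h + 1 := by
      intro u huy hu
      obtain ⟨h1, h2⟩ := ih u hu
      refine ⟨h1, ?_⟩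
      obtain ⟨i, a, ha, hya⟩ := hΦ.exists_update huy
      have h3 := hammingDist_update (Φ x) (Φ u) i a
      rw [← hya] at h3
      by_cases e1 : Φ x i = Φ u i
      · have e2 : Φ x i ≠ a := fun h' => ha (h'.symm.trans e1)
        simp [e1, ha.symm] at h3
        omega
      by_cases e2 : Φ x i = a
      · simp only [e2, ne_eq, ha, not_false_eq_true, if_true, not_true_eq_false, if_false] at h3
        have := h2 y huy (by omega)
        omega
      -- A step that keeps the coordinate wrong is shortcut by the vertex `v` with the correct
      -- coordinate: it is closer to `x` than `u`, and adjacent to `y` by the triangle property.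
      · obtain ⟨v, huv, hv⟩ := hΦ.exists_adj u i (Φ x i) e1
        have h4 := hammingDist_update (Φ x) (Φ u) i (Φ x i)
        rw [← hv] at h4
        simp only [ne_eq, e1, not_false_eq_true, if_true, not_true_eq_false, if_false] at h4
        have h5 := h2 v huv (by omega)
        have h6 : G.Adj v y := hΦ.adj_of_update (i := i) (a := a) huv huy
          (by rw [hv, update_self]; exact Ne.symm e2) (by rw [hv, update_idem, hya])
        have := step h6
        omega
    obtain ⟨u, huy, hu⟩ := exists_adj_dist_eq hG hy
    obtain ⟨hu1, hy1⟩ := main u huy hu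
    refine ⟨hy1, fun z hyz hz => ?_⟩
    have hz' : hammingDist (Φ x) (Φ z) = h := by omega
    have towards : ∀ {v}, G.Adj y v → hammingDist (Φ x) (Φ v) = h →
        ∃ i, Φ x i ≠ Φ y i ∧ Φ v = update (Φ y) i (Φ x i) := by
      intro v hyv hv
      obtain ⟨i, a, ha, hva⟩ := hΦ.exists_update hyv
      have h3 := hammingDist_update (Φ x) (Φ y) i a
      rw [← hva, hv, hy1] at h3
      have e1 : Φ x i = a := by
        by_contra e1
        split_ifs at h3 <;> omega
      exact ⟨i, e1 ▸ ha, e1 ▸ hva⟩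
    obtain ⟨i, hi, hui⟩ := towards huy.symm hu1
    obtain ⟨j, hj, hzj⟩ := towards hyz hz'
    by_cases hij : i = j
    · subst hij
      obtain rfl := hΦ.eq_of_eq huy.symm hyz (hui.trans hzj.symm)
      omega
    -- Correcting the coordinates `i` and `j` together gives `w`, one step closer to `x` than `u`;
    -- hence its neighbour `z` is at distance at most `h`.
    · obtain ⟨w, huw, hwz, hw⟩ := hΦ.quad huy.symm hyz hij hi hj hui hzj
      have h4 := hammingDist_update (Φ x) (Φ u) j (Φ x j)
      rw [hui, ← hw, ← hui, hui, update_of_ne (Ne.symm hij), ← hui] at h4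
      simp only [ne_eq, hj, not_false_eq_true, if_true, not_true_eq_false, if_false] at h4
      have h5 := (ih u hu).2 w huw (by omega)
      have h6 := step hwz
      have h7 := step hyz.symm
      omega

lemma dist_eq (hΦ : G.IsHammingCovering Φ) (hG : G.Connected) (x y : V) :
    G.dist x y = hammingDist (Φ x) (Φ y) :=
  ((hΦ.dist_aux hG x _ y rfl).1).symm

lemma injective (hΦ : G.IsHammingCovering Φ) (hG : G.Connected) : Injective Φ := fun x y h => by
  rw [← hG.dist_eq_zero_iff, hΦ.dist_eq hG, h, hammingDist_self]

lemma surjective (hΦ : G.IsHammingCovering Φ) (hG : G.Connected) : Surjective Φ := by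
  intro w
  obtain ⟨x⟩ := hG.nonempty
  have key : ∀ S : Finset (Fin m), ∃ y, Φ y = S.piecewise w (Φ x) := by
    intro S
    induction S using Finset.induction_on with
    | empty => exact ⟨x, by simp⟩
    | insert i S _ ih =>
      obtain ⟨y, hy⟩ := ih
      rw [Finset.piecewise_insert, ← hy]
      by_cases h : w i = Φ y i
      · exact ⟨y, by rw [h, update_eq_self]⟩
      · obtain ⟨z, -, hz⟩ := hΦ.exists_adj y i (w i) h
        exact ⟨z, hz⟩
  simpa using key Finset.univ

/-- A Hamming covering of a connected graph is an isomorphism. -/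
noncomputable def iso (hΦ : G.IsHammingCovering Φ) (hG : G.Connected) : G ≃g hammingGraph m s where
  toEquiv := Equiv.ofBijective Φ ⟨hΦ.injective hG, hΦ.surjective hG⟩
  map_rel_iff' {x y} := by
    change hammingDist (Φ x) (Φ y) = 1 ↔ _
    rw [← hΦ.dist_eq hG, dist_eq_one_iff_adj]

lemma diam_eq [Finite V] (hΦ : G.IsHammingCovering Φ) (hG : G.Connected) (hs : 2 ≤ s) :
    G.diam = m := by
  have := hG.nonempty
  apply le_antisymm
  · obtain ⟨x, y, hxy⟩ := G.exists_dist_eq_diam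
    rw [← hxy, hΦ.dist_eq hG]
    exact hammingDist_le_card_fintype.trans (by simp)
  · obtain ⟨x, hx⟩ := hΦ.surjective hG fun _ => ⟨0, by omega⟩
    obtain ⟨y, hy⟩ := hΦ.surjective hG fun _ => ⟨1, by omega⟩
    have h1 : G.dist x y = m := by
      rw [hΦ.dist_eq hG, hx, hy]
      simp [hammingDist]
    rw [← h1]
    exact dist_le_diam (connected_iff_ediam_ne_top.mp hG)

end IsHammingCovering

end Coordinates

/-! ### Orthogonal coordinates from the lines through a vertex. -/

section Frames

open Function

variable {V : Type*}

/-- The vertices `σ i a` with `i` fixed form a clique through `x₀ = σ i 0`, and these cliques are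
pairwise disjoint and non-adjacent outside `x₀`. -/
structure IsFrame (G : SimpleGraph V) {m s : ℕ} [NeZero s] (x₀ : V) (σ : Fin m → Fin s → V) :
    Prop where
  zero : ∀ i, σ i 0 = x₀
  adj : ∀ {i a b}, a ≠ b → G.Adj (σ i a) (σ i b)
  ne : ∀ {i j a b}, i ≠ j → a ≠ 0 → b ≠ 0 → σ i a ≠ σ j b
  not_adj : ∀ {i j a b}, i ≠ j → a ≠ 0 → b ≠ 0 → ¬ G.Adj (σ i a) (σ j b)

variable [Fintype V] [DecidableEq V] {G : SimpleGraph V} [DecidableRel G.Adj] {E : Type*}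
  [NormedAddCommGroup E] [InnerProductSpace ℝ E] {k l : ℕ} {θ α β ε : ℝ} {H : V → E}
  {m s : ℕ} [NeZero s] {x₀ : V} {σ : Fin m → Fin s → V}

/-- The point with coordinates `w` in the frame `σ`. -/
def framePoint (H : V → E) (x₀ : V) (σ : Fin m → Fin s → V) (w : Fin m → Fin s) : E :=
  H x₀ + ∑ i, (H (σ i (w i)) - H x₀)

lemma framePoint_update (w : Fin m → Fin s) (i : Fin m) (a : Fin s) :
    framePoint H x₀ σ (update w i a) = framePoint H x₀ σ w + (H (σ i a) - H (σ i (w i))) := by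
  unfold framePoint
  rw [← Finset.add_sum_erase _ _ (Finset.mem_univ i),
    ← Finset.add_sum_erase (a := i) _ (fun j => H (σ j (w j)) - H x₀) (Finset.mem_univ i)]
  have : ∑ j ∈ Finset.univ.erase i, (H (σ j (update w i a j)) - H x₀) =
      ∑ j ∈ Finset.univ.erase i, (H (σ j (w j)) - H x₀) := by
    refine Finset.sum_congr rfl fun j hj => ?_
    rw [update_of_ne (Finset.ne_of_mem_erase hj)]
  rw [this, update_self]
  abel

namespace IsAlmostParallelogramRep

/-- The converse of Pythagoras, from β = 2α. -/
lemma inner_frame (R : G.IsAlmostParallelogramRep k l θ α β ε H) (F : G.IsFrame x₀ σ)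
    {i j : Fin m} (hij : i ≠ j) (a b : Fin s) :
    inner ℝ (H (σ i a) - H x₀) (H (σ j b) - H x₀) = 0 := by
  by_cases ha : a = 0
  · simp [ha, F.zero]
  by_cases hb : b = 0
  · simp [hb, F.zero]
  have h1 : G.Adj x₀ (σ i a) := F.zero i ▸ F.adj (Ne.symm ha)
  have h2 : G.Adj x₀ (σ j b) := F.zero j ▸ F.adj (Ne.symm hb)
  obtain ⟨y, hy⟩ := R.exists_quad h1 h2 (F.ne hij ha hb) (F.not_adj hij ha hb)
  have h3 := norm_sub_sq_real (H (σ i a) - H x₀) (H (σ j b) - H x₀)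
  rw [sub_sub_sub_cancel_right, R.norm_adj h1.symm, R.norm_adj h2.symm,
    R.norm_two h1.symm h2 (F.ne hij ha hb) (F.not_adj hij ha hb), R.beta_eq hy] at h3
  linarith

lemma norm_framePoint_sub (R : G.IsAlmostParallelogramRep k l θ α β ε H) (F : G.IsFrame x₀ σ)
    (v w : Fin m → Fin s) :
    ‖framePoint H x₀ σ v - framePoint H x₀ σ w‖ ^ 2 = α * hammingDist v w := by
  have h1 : framePoint H x₀ σ v - framePoint H x₀ σ w =
      ∑ i, ((H (σ i (v i)) - H x₀) - (H (σ i (w i)) - H x₀)) := by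
    rw [Finset.sum_sub_distrib]
    unfold framePoint
    abel
  rw [h1, ← real_inner_self_eq_norm_sq, sum_inner]
  simp_rw [inner_sum]
  have h2 : ∀ i, ∑ j, inner ℝ ((H (σ i (v i)) - H x₀) - (H (σ i (w i)) - H x₀))
      ((H (σ j (v j)) - H x₀) - (H (σ j (w j)) - H x₀)) = if v i ≠ w i then α else 0 := by
    intro i
    rw [Finset.sum_eq_single i]
    · rw [sub_sub_sub_cancel_right, real_inner_self_eq_norm_sq]
      split_ifs with h
      · exact R.norm_adj (F.adj h)
      · rw [not_not] at h
        simp [h]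
    · intro j _ hj
      rw [inner_sub_left, inner_sub_right _ (H (σ j (v j)) - H x₀),
        inner_sub_right _ (H (σ j (v j)) - H x₀), R.inner_frame F hj.symm,
        R.inner_frame F hj.symm, R.inner_frame F hj.symm, R.inner_frame F hj.symm]
      simp
    · simp
  rw [Finset.sum_congr rfl fun i _ => h2 i, hammingDist, ← Finset.sum_filter, Finset.sum_const,
    nsmul_eq_mul, mul_comm]

lemma framePoint_injective (R : G.IsAlmostParallelogramRep k l θ α β ε H) (F : G.IsFrame x₀ σ) :
    Injective (framePoint H x₀ σ) := by
  intro v w h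
  have h1 := R.norm_framePoint_sub F v w
  rw [h, sub_self, norm_zero] at h1
  have h2 : (hammingDist v w : ℝ) = 0 := by
    have := R.pos
    by_contra h3
    exact (mul_ne_zero this.ne' h3) (by linarith)
  exact hammingDist_eq_zero.mp (by exact_mod_cast h2)

/-- Distinct vertices with a common neighbour have squared distance α or β > α, so Hamming distance
decides between equality, adjacency and distance two. -/
lemma dichotomy (R : G.IsAlmostParallelogramRep k l θ α β ε H) (F : G.IsFrame x₀ σ)
    {x y z : V} (hy : G.Adj x y) (hz : G.Adj x z) {v w : Fin m → Fin s}
    (hv : H y = framePoint H x₀ σ v) (hw : H z = framePoint H x₀ σ w) :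
    (v = w → y = z) ∧ (hammingDist v w = 1 → G.Adj y z) ∧
      (hammingDist v w = 2 → y ≠ z ∧ ¬ G.Adj y z) := by
  have h1 := R.norm_framePoint_sub F v w
  rw [← hv, ← hw] at h1
  have hp := R.pos
  have hb := R.beta_pos
  refine ⟨fun h => R.eq_of_norm_lt hy hz (by rw [h1, h, hammingDist_self]; simpa using hp),
    fun h => ?_, fun h => ⟨?_, fun hn => ?_⟩⟩
  · rw [h] at h1
    by_contra hn
    have hne : y ≠ z := by
      rintro rfl
      rw [sub_self, norm_zero] at h1
      norm_num at h1
      exact hp.ne h1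
    have := R.norm_two hy.symm hz hne hn
    norm_num at h1
    linarith
  · rintro rfl
    rw [h, sub_self, norm_zero] at h1
    norm_num at h1
    exact hp.ne' h1
  · rw [R.norm_adj hn, h] at h1
    push_cast at h1
    linarith

/-- `x` is represented by the point with coordinates `w`, and all the points which differ from it
in one coordinate represent neighbours of `x`. -/
def Realizes (G : SimpleGraph V) (H : V → E) (x₀ : V) (σ : Fin m → Fin s → V) (x : V)
    (w : Fin m → Fin s) : Prop :=
  H x = framePoint H x₀ σ w ∧
    ∀ i a, a ≠ w i → ∃ y, G.Adj x y ∧ H y = framePoint H x₀ σ (update w i a)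

lemma hammingDist_update_update {w : Fin m → Fin s} {i j : Fin m} (hij : i ≠ j) {a b : Fin s}
    (ha : a ≠ w i) (hb : b ≠ w j) : hammingDist (update w i a) (update w j b) = 2 := by
  have h1 := hammingDist_update (update w i a) w j b
  have h2 := hammingDist_self_update w i ha
  rw [hammingDist_comm _ w, h2, update_of_ne hij.symm] at h1
  simpa [hb.symm] using h1

lemma Realizes.exists_quad (R : G.IsAlmostParallelogramRep k l θ α β ε H) (F : G.IsFrame x₀ σ)
    {x y z : V} {w : Fin m → Fin s} (hx : H x = framePoint H x₀ σ w) {i j : Fin m} (hij : i ≠ j)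
    {a b : Fin s} (ha : a ≠ w i) (hb : b ≠ w j) (hxy : G.Adj x y) (hxz : G.Adj x z)
    (hy : H y = framePoint H x₀ σ (update w i a)) (hz : H z = framePoint H x₀ σ (update w j b)) :
    ∃ v, G.IsQuad x y v z ∧ H v = framePoint H x₀ σ (update (update w i a) j b) := by
  obtain ⟨hne, hn⟩ := (R.dichotomy F hxy hxz hy hz).2.2 (hammingDist_update_update hij ha hb)
  obtain ⟨v, hv⟩ := R.exists_quad hxy hxz hne hn
  refine ⟨v, hv, ?_⟩
  have h1 := R.add_eq_add hv
  rw [hx, hy, hz, framePoint_update w j b] at h1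
  rw [framePoint_update (update w i a), update_of_ne hij.symm]
  have h2 : H v = framePoint H x₀ σ w + H v - framePoint H x₀ σ w := by abel
  rw [h2, h1]
  abel

lemma Realizes.step (R : G.IsAlmostParallelogramRep k l θ α β ε H) (F : G.IsFrame x₀ σ)
    {x y : V} {w : Fin m → Fin s} (hx : Realizes G H x₀ σ x w) {i : Fin m} {a : Fin s}
    (ha : a ≠ w i) (hxy : G.Adj x y) (hy : H y = framePoint H x₀ σ (update w i a)) :
    Realizes G H x₀ σ y (update w i a) := by
  refine ⟨hy, fun j b hb => ?_⟩
  by_cases hij : i = j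
  · subst hij
    rw [update_idem]
    by_cases hbw : b = w i
    · exact ⟨x, hxy.symm, by rw [hbw, update_eq_self, hx.1]⟩
    · obtain ⟨z, hxz, hz⟩ := hx.2 i b hbw
      refine ⟨z, (R.dichotomy F hxy hxz hy hz).2.1 ?_, hz⟩
      have := hammingDist_self_update (update w i a) i hb
      rwa [update_idem] at this
  · rw [update_of_ne (Ne.symm hij)] at hb
    obtain ⟨z, hxz, hz⟩ := hx.2 j b hb
    obtain ⟨v, hv, hv'⟩ := Realizes.exists_quad R F hx.1 hij ha hb hxy hxz hy hz
    exact ⟨v, hv.py, hv'⟩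

/-- Exactly `m * (s - 1)` words differ from `w` in one position. This is the degree, so the realized
neighbours are all the neighbours. -/
lemma Realizes.exists_update (R : G.IsAlmostParallelogramRep k l θ α β ε H) (F : G.IsFrame x₀ σ)
    (hk : k = m * (s - 1)) {x y : V} {w : Fin m → Fin s} (hx : Realizes G H x₀ σ x w)
    (hxy : G.Adj x y) : ∃ i a, a ≠ w i ∧ H y = framePoint H x₀ σ (update w i a) := by
  choose f hf hf' using hx.2
  let g : (Σ i, {a // a ≠ w i}) → G.neighborSet x := fun p => ⟨f p.1 p.2 p.2.2, hf p.1 p.2 p.2.2⟩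
  have hg : Injective g := by
    rintro ⟨i, a, ha⟩ ⟨j, b, hb⟩ h
    have h1 : f i a ha = f j b hb := congrArg Subtype.val h
    have h2 := R.framePoint_injective F ((hf' i a ha).symm.trans ((congrArg H h1).trans (hf' j b hb)))
    have hij : i = j := by
      by_contra hij
      have := hammingDist_update_update hij ha hb
      rw [h2, hammingDist_self] at this
      omega
    subst hij
    have h3 := congrFun h2 i
    rw [update_self, update_self] at h3
    subst h3
    rfl
  have hcard : Fintype.card (Σ i, {a // a ≠ w i}) = Fintype.card (G.neighborSet x) := by
    rw [card_neighborSet_eq_degree, R.regular x, hk, Fintype.card_sigma]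
    simp [Fintype.card_subtype_compl]
  obtain ⟨⟨i, a, ha⟩, h⟩ := ((Fintype.bijective_iff_injective_and_card g).mpr ⟨hg, hcard⟩).2 ⟨y, hxy⟩
  refine ⟨i, a, ha, ?_⟩
  rw [← hf' i a ha]
  exact congrArg (fun z => H z.1) h.symm

lemma exists_isHammingCovering (R : G.IsAlmostParallelogramRep k l θ α β ε H)
    (F : G.IsFrame x₀ σ) (hk : k = m * (s - 1)) (hG : G.Connected) :
    ∃ Φ : V → Fin m → Fin s, G.IsHammingCovering Φ := by
  have base : Realizes G H x₀ σ x₀ 0 := by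
    have h0 : framePoint H x₀ σ 0 = H x₀ := by simp [framePoint, F.zero]
    refine ⟨h0.symm, fun i a ha => ⟨σ i a, ?_, ?_⟩⟩
    · rw [← F.zero i]
      exact F.adj (Ne.symm ha)
    · rw [framePoint_update, h0, Pi.zero_apply, F.zero]
      abel
  have all : ∀ x, ∃ w, Realizes G H x₀ σ x w := by
    intro x
    have := (reachable_iff_reflTransGen x₀ x).mp (hG.preconnected x₀ x)
    induction this with
    | refl => exact ⟨0, base⟩
    | tail _ hyz ih =>
      obtain ⟨w, hw⟩ := ih
      obtain ⟨i, a, ha, h⟩ := hw.exists_update R F hk hyz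
      exact ⟨_, hw.step R F ha hyz h⟩
  choose Φ hΦ using all
  have hinj := R.framePoint_injective F
  refine ⟨Φ, ?_, ?_, ?_, ?_, ?_⟩
  · intro x y hxy
    obtain ⟨i, a, ha, h⟩ := (hΦ x).exists_update R F hk hxy
    exact ⟨i, a, ha, hinj ((hΦ y).1.symm.trans h)⟩
  · intro x i a ha
    obtain ⟨y, hxy, hy⟩ := (hΦ x).2 i a ha
    exact ⟨y, hxy, hinj ((hΦ y).1.symm.trans hy)⟩
  · intro x y z hxy hxz h
    exact (R.dichotomy F hxy hxz (hΦ y).1 (hΦ z).1).1 h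
  · intro x y z i a hxy hxz ha h
    refine (R.dichotomy F hxy hxz (hΦ y).1 (hΦ z).1).2.1 ?_
    rw [h]
    exact hammingDist_self_update _ i ha
  · intro x y z i j a b hxy hxz hij ha hb hy hz
    obtain ⟨v, hv, hv'⟩ := Realizes.exists_quad R F (hΦ x).1 hij ha hb hxy hxz
      (by rw [← hy]; exact (hΦ y).1) (by rw [← hz]; exact (hΦ z).1)
    exact ⟨v, hv.py, hv.yz, hinj ((hΦ v).1.symm.trans hv')⟩

end IsAlmostParallelogramRep

end Frames

/-! ### Clique geometries and the smallest eigenvalue. -/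

section Geometric

variable {V : Type*} [Fintype V] [DecidableEq V]

/-- A set of cliques of size `s` which partition the edges of `G`. -/
structure IsCliqueGeometry (G : SimpleGraph V) (𝒞 : Finset (Finset V)) (s : ℕ) : Prop where
  isClique : ∀ {C}, C ∈ 𝒞 → G.IsClique (C : Set V)
  card_eq : ∀ {C}, C ∈ 𝒞 → C.card = s
  exists_mem : ∀ {x y}, G.Adj x y → ∃ C ∈ 𝒞, x ∈ C ∧ y ∈ C
  eq_of_mem : ∀ {x y C D}, x ≠ y → C ∈ 𝒞 → D ∈ 𝒞 → x ∈ C → y ∈ C → x ∈ D → y ∈ D → C = D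
  two_le : 2 ≤ s

namespace IsCliqueGeometry

variable {G : SimpleGraph V} [DecidableRel G.Adj] {𝒞 : Finset (Finset V)} {s k : ℕ}

lemma adj (h : G.IsCliqueGeometry 𝒞 s) {C : Finset V} (hC : C ∈ 𝒞) {x y : V} (hx : x ∈ C)
    (hy : y ∈ C) (hne : x ≠ y) : G.Adj x y :=
  h.isClique hC (by exact_mod_cast hx) (by exact_mod_cast hy) hne

lemma sum_sum (h : G.IsCliqueGeometry 𝒞 s) (f : V → ℝ) (x : V) :
    ∑ C ∈ 𝒞 with x ∈ C, ∑ y ∈ C, f y =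
      (𝒞.filter (x ∈ ·)).card * f x + ∑ y ∈ G.neighborFinset x, f y := by
  have h1 : G.neighborFinset x = (𝒞.filter (x ∈ ·)).biUnion (fun C => C.erase x) := by
    ext y
    simp only [mem_neighborFinset, Finset.mem_biUnion, Finset.mem_filter, Finset.mem_erase]
    constructor
    · intro hxy
      obtain ⟨C, hC, hx, hy⟩ := h.exists_mem hxy
      exact ⟨C, ⟨hC, hx⟩, hxy.ne', hy⟩
    · rintro ⟨C, ⟨hC, hx⟩, hne, hy⟩
      exact h.adj hC hx hy hne.symm
  rw [h1, Finset.sum_biUnion, ← nsmul_eq_mul, ← Finset.sum_const, ← Finset.sum_add_distrib]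
  · refine Finset.sum_congr rfl fun C hC => ?_
    exact (Finset.add_sum_erase _ _ (Finset.mem_filter.mp hC).2).symm
  · intro C hC D hD hne
    simp only [Finset.coe_filter, Set.mem_ofPred_eq] at hC hD
    refine Finset.disjoint_left.mpr fun y hy hy' => hne ?_
    rw [Finset.mem_erase] at hy hy'
    exact h.eq_of_mem hy.1 hC.1 hD.1 hy.2 hC.2 hy'.2 hD.2

lemma card_mul (h : G.IsCliqueGeometry 𝒞 s) (hk : G.IsRegularOfDegree k) (x : V) :
    k = (𝒞.filter (x ∈ ·)).card * (s - 1) := by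
  have h1 := h.sum_sum (fun _ => 1) x
  have h2 : ∀ C ∈ 𝒞.filter (x ∈ ·), ∑ y ∈ C, (1 : ℝ) = s := fun C hC => by
    rw [Finset.sum_const, h.card_eq (Finset.mem_filter.mp hC).1]; simp
  rw [Finset.sum_congr rfl h2, Finset.sum_const, Finset.sum_const,
    card_neighborFinset_eq_degree, hk x] at h1
  simp only [nsmul_eq_mul, mul_one] at h1
  have h3 : (𝒞.filter (x ∈ ·)).card * s = (𝒞.filter (x ∈ ·)).card + k := by exact_mod_cast h1
  rw [Nat.mul_sub, h3]
  omega

/-- The cliques of a geometry are Delsarte cliques: eigenfunctions of the least possible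
eigenvalue sum to zero on each of them. -/
lemma sum_eq_zero (h : G.IsCliqueGeometry 𝒞 s) (hk : G.IsRegularOfDegree k) {m : ℝ}
    (hm : (k : ℝ) = m * (s - 1)) {f : V → ℝ} (hf : G.IsEigenfunction (-m) f)
    {C : Finset V} (hC : C ∈ 𝒞) : ∑ x ∈ C, f x = 0 := by
  have hs : (1 : ℝ) < s := by exact_mod_cast h.two_le
  have h1 : ∀ x, ((𝒞.filter (x ∈ ·)).card : ℝ) = m := by
    intro x
    have h2 := h.card_mul hk x
    have h3 : (k : ℝ) = (𝒞.filter (x ∈ ·)).card * ((s : ℝ) - 1) := by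
      rw [h2, Nat.cast_mul, Nat.cast_sub (by exact_mod_cast hs.le)]; simp
    rw [hm] at h3
    exact (mul_right_cancel₀ (by linarith) h3).symm
  -- Exchanging the sums gives `∑ x, f x * (m * f x + ∑ y ∈ G.neighborFinset x, f y)`, since each
  -- vertex lies on `m` cliques; the bracket is zero for the eigenvalue `-m`.
  have h2 : ∑ C ∈ 𝒞, (∑ x ∈ C, f x) ^ 2 = 0 := by
    have h3 : ∑ C ∈ 𝒞, (∑ x ∈ C, f x) ^ 2 = ∑ C ∈ 𝒞, ∑ x ∈ C, f x * ∑ y ∈ C, f y := by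
      refine Finset.sum_congr rfl fun C _ => ?_
      rw [sq, Finset.sum_mul]
    rw [h3, Finset.sum_comm' (t' := Finset.univ) (s' := fun x => 𝒞.filter (x ∈ ·)) (by simp)]
    refine Finset.sum_eq_zero fun x _ => ?_
    rw [← Finset.mul_sum, h.sum_sum, h1, hf x]
    ring
  exact pow_eq_zero_iff two_ne_zero |>.mp
    ((Finset.sum_eq_zero_iff_of_nonneg fun C _ => sq_nonneg _).mp h2 C hC)

/-- The number of neighbours in a clique of a vertex at distance one from the clique is
constant. -/
lemma card_adj_eq (h : G.IsCliqueGeometry 𝒞 s) (hG : G.Connected) (hk : G.IsRegularOfDegree k)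
    {m : ℝ} (hm0 : 0 < m) (hm : (k : ℝ) = m * (s - 1)) {v : ℕ → ℝ} (hv0 : v 0 = 1)
    (hv : ∀ y, G.IsEigenfunction (-m) (fun x => v (G.dist y x))) {C D : Finset V} (hC : C ∈ 𝒞)
    (hD : D ∈ 𝒞) {x y : V} (hx : x ∉ C) (hy : y ∉ D) (hxC : ∃ w ∈ C, G.Adj x w)
    (hyD : ∃ w ∈ D, G.Adj y w) :
    (C.filter (G.Adj x)).card = (D.filter (G.Adj y)).card := by
  have hv1 : (k : ℝ) * v 1 = -m := mul_standard_one hk hv0 (hv x)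
  -- The clique lies at distances 1 and 2 from `x`, so the vanishing sum of the radial eigenfunction
  -- is a linear equation for the number of neighbours.
  have key : ∀ {x C}, C ∈ 𝒞 → x ∉ C → (∃ w ∈ C, G.Adj x w) →
      (C.filter (G.Adj x)).card * (v 1 - v 2) + s * v 2 = 0 := by
    intro x C hC hx ⟨w, hw, hxw⟩
    rw [← h.sum_eq_zero hk hm (hv x) hC]
    have h1 : ∀ z ∈ C, v (G.dist x z) = (if G.Adj x z then v 1 - v 2 else 0) + v 2 := by
      intro z hz
      split_ifs with hxz
      · rw [dist_eq_one_iff_adj.mpr hxz]; ring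
      · have h2 : G.dist x z = 2 := by
          have h3 : z ≠ w := by rintro rfl; exact hxz hxw
          have h4 := hG.dist_triangle (u := x) (v := w) (w := z)
          rw [dist_eq_one_iff_adj.mpr hxw, dist_eq_one_iff_adj.mpr (h.adj hC hw hz h3.symm)] at h4
          have h5 : G.dist x z ≠ 1 := fun h' => hxz (dist_eq_one_iff_adj.mp h')
          have h6 : G.dist x z ≠ 0 := fun h' => by
            rw [hG.dist_eq_zero_iff] at h'
            subst h'
            exact hx hz
          omega
        rw [h2]; ring
    rw [Finset.sum_congr rfl h1, Finset.sum_add_distrib, ← Finset.sum_filter, Finset.sum_const,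
      Finset.sum_const, h.card_eq hC, nsmul_eq_mul, nsmul_eq_mul]
  have h1 := key hC hx hxC
  have h2 := key hD hy hyD
  -- If `v 1 = v 2`, the equation forces both to vanish, against `k * v 1 = -m`.
  have h3 : v 1 - v 2 ≠ 0 := by
    intro h3
    have h4 : (s : ℝ) * v 2 = 0 := by rw [h3] at h1; linarith
    have h5 : (s : ℝ) ≠ 0 := by
      have := h.two_le
      positivity
    have h6 : v 2 = 0 := (mul_eq_zero.mp h4).resolve_left h5
    rw [show v 1 = 0 by linarith, mul_zero] at hv1
    linarith
  have h4 : ((C.filter (G.Adj x)).card : ℝ) = (D.filter (G.Adj y)).card :=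
    mul_right_cancel₀ h3 (by linarith)
  exact_mod_cast h4

/-- If some local graph is disconnected, then some vertex outside a clique has exactly one
neighbour in it. -/
lemma exists_card_adj_eq_one (h : G.IsCliqueGeometry 𝒞 s) (hk0 : 0 < k)
    (hk : G.IsRegularOfDegree k) {v : V} (hv : ¬ (G.neighborhoodGraph v).Connected) :
    ∃ C ∈ 𝒞, ∃ x ∉ C, (C.filter (G.Adj x)).card = 1 := by
  by_contra! hcon
  apply hv
  obtain ⟨w, hw⟩ : (G.neighborFinset v).Nonempty := by
    rw [← Finset.card_pos, card_neighborFinset_eq_degree, hk v]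
    exact hk0
  rw [mem_neighborFinset] at hw
  have : Nonempty (G.neighborSet v) := ⟨⟨w, hw⟩⟩
  refine ⟨fun p q => ?_⟩
  have same : ∀ (C : Finset V) (_ : C ∈ 𝒞) (p q : G.neighborSet v), p.1 ∈ C → q.1 ∈ C →
      (G.neighborhoodGraph v).Reachable p q := by
    intro C hC p q hp hq
    by_cases hpq : p = q
    · rw [hpq]
    · exact Adj.reachable (show G.Adj p.1 q.1 from
        h.adj hC hp hq fun h' => hpq (Subtype.ext h'))
  have hvp : G.Adj v p.1 := p.2
  have hvq : G.Adj v q.1 := q.2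
  obtain ⟨C, hC, hvC, hqC⟩ := h.exists_mem hvq
  by_cases hp : p.1 ∈ C
  · exact same C hC p q hp hqC
  · have h1 : v ∈ C.filter (G.Adj p.1) := by simp [hvC, hvp.symm]
    have h2 : 1 < (C.filter (G.Adj p.1)).card := by
      have := hcon C hC p.1 hp
      have := Finset.card_pos.mpr ⟨v, h1⟩
      omega
    -- A second neighbour `r` of `p` in the clique through `v` and `q` links `p` to `q` inside the
    -- neighbourhood of `v`.
    obtain ⟨r, hr, hrv⟩ := Finset.exists_mem_ne h2 v
    rw [Finset.mem_filter] at hr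
    have hvr : G.Adj v r := h.adj hC hvC hr.1 hrv.symm
    have h3 : (G.neighborhoodGraph v).Adj p ⟨r, hvr⟩ := show G.Adj p.1 r from hr.2
    exact h3.reachable.trans (same C hC _ q hr.1 hqC)

/-- Every vertex outside a clique has at most one neighbour in it. -/
def IsPartialLinear (G : SimpleGraph V) (𝒞 : Finset (Finset V)) : Prop :=
  ∀ ⦃C⦄, C ∈ 𝒞 → ∀ ⦃x⦄, x ∉ C → ∀ ⦃y z⦄, y ∈ C → z ∈ C → G.Adj x y → G.Adj x z → y = z





lemma IsPartialLinear.mem_of_adj (hP : IsPartialLinear G 𝒞)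
    {C : Finset V} (hC : C ∈ 𝒞) {x y z : V} (hx : x ∈ C) (hy : y ∈ C)
    (hne : x ≠ y) (hxz : G.Adj x z) (hyz : G.Adj y z) : z ∈ C := by
  by_contra hz
  exact hne (hP hC hz hx hy hxz.symm hyz.symm)

lemma diamondFree (h : G.IsCliqueGeometry 𝒞 s) (hP : IsPartialLinear G 𝒞)
    {x y z w : V} (hxy : G.Adj x y) (hxz : G.Adj x z) (hyz : G.Adj y z)
    (hxw : G.Adj x w) (hyw : G.Adj y w) (hne : z ≠ w) : G.Adj z w := by
  obtain ⟨C, hC, hx, hy⟩ := h.exists_mem hxy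
  exact h.adj hC (hP.mem_of_adj hC hx hy hxy.ne hxz hyz)
    (hP.mem_of_adj hC hx hy hxy.ne hxw hyw) hne

lemma card_common (h : G.IsCliqueGeometry 𝒞 s) (hP : IsPartialLinear G 𝒞)
    {x y : V} (hxy : G.Adj x y) :
    ((G.neighborFinset x).filter (fun w => G.Adj w y)).card = s - 2 := by
  obtain ⟨C, hC, hx, hy⟩ := h.exists_mem hxy
  have h1 : (G.neighborFinset x).filter (fun w => G.Adj w y) = (C.erase x).erase y := by
    ext w
    simp only [Finset.mem_filter, mem_neighborFinset, Finset.mem_erase]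
    constructor
    · rintro ⟨h1, h2⟩
      exact ⟨h2.ne, h1.ne', hP.mem_of_adj hC hx hy hxy.ne h1 h2.symm⟩
    · rintro ⟨h1, h2, h3⟩
      exact ⟨h.adj hC hx h3 h2.symm, h.adj hC h3 hy h1⟩
  rw [h1, Finset.card_erase_of_mem (by simp [hxy.ne', hy]), Finset.card_erase_of_mem hx,
    h.card_eq hC]
  omega

lemma exists_isFrame [NeZero s] (h : G.IsCliqueGeometry 𝒞 s) (hP : IsPartialLinear G 𝒞)
    (x₀ : V) :
    ∃ σ : Fin (𝒞.filter (x₀ ∈ ·)).card → Fin s → V, G.IsFrame x₀ σ := by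
  have h1 : ∀ C ∈ 𝒞.filter (x₀ ∈ ·), ∃ e : Fin s ≃ C, (e 0).1 = x₀ := by
    intro C hC
    rw [Finset.mem_filter] at hC
    let e := (C.equivFinOfCardEq (h.card_eq hC.1)).symm
    refine ⟨(Equiv.swap 0 (e.symm ⟨x₀, hC.2⟩)).trans e, ?_⟩
    simp
  choose e he using h1
  let f := (𝒞.filter (x₀ ∈ ·)).equivFin.symm
  have hf : ∀ i, (f i).1 ∈ 𝒞 ∧ x₀ ∈ (f i).1 := fun i => Finset.mem_filter.mp (f i).2
  have hmem : ∀ i a, (e (f i).1 (f i).2 a).1 ∈ (f i).1 := fun i a => (e _ _ a).2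
  have hne0 : ∀ i a, a ≠ 0 → (e (f i).1 (f i).2 a).1 ≠ x₀ := by
    intro i a ha h'
    exact ha ((e _ _).injective (Subtype.ext (h'.trans (he (f i).1 (f i).2).symm)))
  have hnot : ∀ i j a, i ≠ j → a ≠ 0 → (e (f i).1 (f i).2 a).1 ∉ (f j).1 := by
    intro i j a hij ha h'
    exact hij (f.injective (Subtype.ext
      (h.eq_of_mem (hne0 i a ha) (hf i).1 (hf j).1 (hmem i a) (hf i).2 h' (hf j).2)))
  refine ⟨fun i a => (e (f i).1 (f i).2 a).1, fun i => he _ _, ?_, ?_, ?_⟩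
  · intro i a b hab
    exact h.adj (hf i).1 (hmem i a) (hmem i b) fun h' => hab ((e _ _).injective (Subtype.ext h'))
  · intro i j a b hij ha hb h'
    exact hnot i j a hij ha (h' ▸ hmem j b)
  · intro i j a b hij ha hb hadj
    exact hne0 j b hb (hP (hf j).1 (hnot i j a hij ha) (hmem j b) (hf j).2 hadj
      (h.adj (hf i).1 (hmem i a) (hf i).2 (hne0 i a ha)))

lemma isPartialLinear (h : G.IsCliqueGeometry 𝒞 s) (hG : G.Connected)
    (hk : G.IsRegularOfDegree k) {m : ℝ} (hm0 : 0 < m) (hm : (k : ℝ) = m * (s - 1)) {v : ℕ → ℝ}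
    (hv0 : v 0 = 1) (hv : ∀ y, G.IsEigenfunction (-m) (fun x => v (G.dist y x))) {x₀ : V}
    (hx₀ : ¬ (G.neighborhoodGraph x₀).Connected) : IsPartialLinear G 𝒞 := by
  have hs : (2 : ℝ) ≤ s := by exact_mod_cast h.two_le
  have hk0 : 0 < k := by
    have : (0 : ℝ) < k := hm ▸ mul_pos hm0 (by linarith)
    exact_mod_cast this
  obtain ⟨D, hD, w, hw, hcard⟩ := h.exists_card_adj_eq_one hk0 hk hx₀
  have hw' : ∃ z ∈ D, G.Adj w z := by
    obtain ⟨z, hz⟩ := Finset.card_pos.mp (hcard ▸ one_pos)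
    exact ⟨z, Finset.mem_filter.mp hz⟩
  intro C hC x hx y z hy hz hxy hxz
  have h1 := h.card_adj_eq hG hk hm0 hm hv0 hv hC hD hx hw ⟨y, hy, hxy⟩ hw'
  exact Finset.card_le_one.mp (h1.trans hcard).le y (by simp [hy, hxy]) z (by simp [hz, hxz])

lemma two_le_card (h : G.IsCliqueGeometry 𝒞 s) {x y z : V} (hzx : G.Adj z x) (hzy : G.Adj z y)
    (hne : x ≠ y) (hn : ¬ G.Adj x y) : 2 ≤ (𝒞.filter (z ∈ ·)).card := by
  obtain ⟨C, hC, hzC, hxC⟩ := h.exists_mem hzx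
  obtain ⟨D, hD, hzD, hyD⟩ := h.exists_mem hzy
  refine Finset.one_lt_card.mpr ⟨C, by simp [hC, hzC], D, by simp [hD, hzD], ?_⟩
  rintro rfl
  exact hn (h.adj hC hxC hyD hne)

end IsCliqueGeometry

/-- The Delsarte cliques of a geometric graph form a clique geometry. -/
lemma IsGeometric.exists_isCliqueGeometry {G : SimpleGraph V} [DecidableRel G.Adj] {k : ℕ}
    {m : ℝ} (hgeom : G.IsGeometric) (hk : G.IsRegularOfDegree k)
    (hm : G.IsSmallestEigenvalue (-m)) {x y : V} (hxy : G.Adj x y) :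
    ∃ (𝒞 : Finset (Finset V)) (s : ℕ), G.IsCliqueGeometry 𝒞 s ∧ 0 < m ∧
      (k : ℝ) = m * (s - 1) := by
  classical
  obtain ⟨𝒞, h1, h2⟩ := hgeom
  have hcard : ∀ C ∈ 𝒞, (C.card : ℝ) = 1 + k / m := by
    intro C hC
    obtain ⟨-, k', θ, hk', hθ, h3⟩ := h1 C hC
    rw [h3, hθ.unique hm, ← hk' x, hk x, div_neg]
    ring
  obtain ⟨C₀, ⟨hC₀, hx, hy⟩, -⟩ := h2 x y hxy
  have hs : 2 ≤ C₀.card := Finset.one_lt_card.mpr ⟨x, hx, y, hy, hxy.ne⟩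
  have hs' : (2 : ℝ) ≤ C₀.card := by exact_mod_cast hs
  have h4 := hcard C₀ hC₀
  have hm0 : 0 < m := by
    by_contra! h5
    have : (k : ℝ) / m ≤ 0 := div_nonpos_of_nonneg_of_nonpos (Nat.cast_nonneg k) h5
    linarith
  refine ⟨Finset.univ.filter (· ∈ 𝒞), C₀.card, ⟨?_, ?_, ?_, ?_, hs⟩, hm0, ?_⟩
  · intro C hC
    exact (h1 C (by simpa using hC)).1
  · intro C hC
    have := hcard C (by simpa using hC)
    rw [← h4] at this
    exact_mod_cast this
  · intro u v huv
    obtain ⟨C, ⟨hC, hu, hv⟩, -⟩ := h2 u v huv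
    exact ⟨C, by simpa using hC, hu, hv⟩
  · intro u v C D hne hC hD huC hvC huD hvD
    have hC' : C ∈ 𝒞 := by simpa using hC
    have huv : G.Adj u v := (h1 C hC').1 (by exact_mod_cast huC) (by exact_mod_cast hvC) hne
    exact (h2 u v huv).unique ⟨hC', huC, hvC⟩ ⟨by simpa using hD, huD, hvD⟩
  · rw [h4]
    field_simp
    ring

end Geometric

/-! ### The Euclidean representation attached to θ₁. -/

section StandardRepresentation

variable {V : Type*} [Fintype V] [DecidableEq V] {G : SimpleGraph V} [DecidableRel G.Adj]
  {d k : ℕ} {a b c : ℕ → ℕ}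

/-- The representation of the vertices by the radial extensions of `u`. -/
noncomputable def radialRep (G : SimpleGraph V) (u : ℕ → ℝ) (x : V) : EuclideanSpace ℝ V :=
  WithLp.toLp 2 fun z => u (G.dist x z)

lemma norm_radialRep_sub {u : ℕ → ℝ} {κ : ℝ} (hu0 : u 0 = 1)
    (hκ : ∀ x y, ∑ z, u (G.dist x z) * u (G.dist y z) = κ * u (G.dist x y)) (x y : V) :
    ‖radialRep G u x - radialRep G u y‖ ^ 2 = 2 * κ * (1 - u (G.dist x y)) := by
  have h1 : ∀ z, (u (G.dist x z) - u (G.dist y z)) ^ 2 =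
      u (G.dist x z) * u (G.dist x z) + u (G.dist y z) * u (G.dist y z) -
        2 * (u (G.dist x z) * u (G.dist y z)) := fun z => by ring
  rw [EuclideanSpace.real_norm_sq_eq]
  simp only [radialRep, PiLp.sub_apply]
  simp_rw [h1]
  rw [Finset.sum_sub_distrib, Finset.sum_add_distrib, ← Finset.mul_sum, hκ, hκ, hκ, dist_self,
    dist_self, hu0]
  ring

lemma sum_radialRep {u : ℕ → ℝ} {θ : ℝ}
    (hu : ∀ y, G.IsEigenfunction θ (fun x => u (G.dist y x))) (x : V) :
    ∑ w ∈ G.neighborFinset x, radialRep G u w = θ • radialRep G u x := by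
  ext z
  have h1 : ∑ w ∈ G.neighborFinset x, u (G.dist z w) = θ * u (G.dist z x) := hu z x
  simp only [dist_comm (u := z)] at h1
  simpa [radialRep] using h1

lemma dist_eq_two {G : SimpleGraph V} {x z y : V} (hxz : G.Adj x z) (hzy : G.Adj z y)
    (hne : x ≠ y) (hn : ¬ G.Adj x y) : G.dist x y = 2 := by
  have h1 : G.dist x y ≤ 2 := dist_le (Walk.cons hxz (Walk.cons hzy Walk.nil))
  have h2 : G.dist x y ≠ 1 := fun h => hn (dist_eq_one_iff_adj.mp h)
  have h3 : G.dist x y ≠ 0 := fun h =>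
    hne ((Reachable.dist_eq_zero_iff (hxz.reachable.trans hzy.reachable)).mp h)
  omega

namespace IsDistanceRegularWith

lemma exists_common (h : G.IsDistanceRegularWith d a b c) (hμ : 2 ≤ c 2) {p x z : V}
    (hpx : G.Adj p x) (hxz : G.Adj x z) (hne : p ≠ z) (hn : ¬ G.Adj p z) :
    ∃ y, y ≠ x ∧ G.Adj p y ∧ G.Adj y z := by
  have h1 := h.card_prev p z
  rw [dist_eq_two hpx hxz hne hn] at h1
  obtain ⟨y, hy, hyx⟩ := Finset.exists_mem_ne (lt_of_lt_of_le one_lt_two (h1 ▸ hμ)) x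
  simp only [Finset.mem_filter, mem_neighborFinset] at hy
  exact ⟨y, hyx, dist_eq_one_iff_adj.mp (by omega), hy.1.symm⟩

/-- The standard representation of a distance-regular graph without diamonds for an eigenvalue
close to `b₁` maps quadrangles to approximate parallelograms. -/
lemma isAlmostParallelogramRep (h : G.IsDistanceRegularWith d a b c) (hd : 2 ≤ d)
    (hk : G.IsRegularOfDegree k) (hμ : 2 ≤ c 2)
    (hdf : ∀ {x y z w}, G.Adj x y → G.Adj x z → G.Adj y z → G.Adj x w → G.Adj y w →
      z ≠ w → G.Adj z w) {l : ℕ}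
    (hl : ∀ {x y}, G.Adj x y → ((G.neighborFinset x).filter (fun w => G.Adj w y)).card = l)
    {θ ε κ : ℝ} (hθ : θ < k) (hgap : (1 - ε) * b 1 ≤ θ) (hε₀ : 0 < ε) (hε : 192 * ε ≤ 1)
    (hεk : ε * k < l + 1) {u : ℕ → ℝ} (hu0 : u 0 = 1)
    (hu : ∀ y, G.IsEigenfunction θ (fun x => u (G.dist y x))) (hκ0 : 0 < κ)
    (hκ : ∀ x y, ∑ z, u (G.dist x z) * u (G.dist y z) = κ * u (G.dist x y)) :
    G.IsAlmostParallelogramRep k l θ (2 * κ * (1 - u 1)) (2 * κ * (1 - u 2)) ε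
      (radialRep G u) := by
  obtain ⟨x, y, hxy⟩ := h.exists_dist_eq (i := 1) (by omega)
  have hadj := dist_eq_one_iff_adj.mp hxy
  have hc1 := h.c_one (by omega)
  have hb1 : 0 < b 1 := h.b_pos hd
  have ha1 : a 1 = l := by
    rw [← hl hadj.symm, ← hxy, ← h.card_same]
    congr 1
    ext w
    simp [hxy, dist_eq_one_iff_adj, adj_comm _ x]
  have hsum := h.add_add_eq hk x y
  rw [hxy, hc1, ha1] at hsum
  have hu1 := mul_standard_one hk hu0 (hu x)
  have hu2 : ∑ w ∈ G.neighborFinset y, u (G.dist x w) = θ * u (G.dist x y) := hu x y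
  rw [h.sum_neighbor_radial u x y, hxy, hc1, ha1] at hu2
  norm_num [hu0] at hu2
  have hkR : (k : ℝ) = l + b 1 + 1 := by rw [← hsum]; push_cast; ring
  have hb1R : (0 : ℝ) < b 1 := by exact_mod_cast hb1
  have hlR : (0 : ℝ) ≤ l := Nat.cast_nonneg l
  have hkpos : (0 : ℝ) < k := by linarith
  have hu1lt : u 1 < 1 := by
    by_contra! h1
    nlinarith
  refine ⟨hdf, h.exists_common hμ, hk, hl, ?_, ?_, sum_radialRep hu, ?_, ?_, hε, ?_⟩
  · intro x y hxy
    rw [norm_radialRep_sub hu0 hκ, dist_eq_one_iff_adj.mpr hxy]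
  · intro x z y hxz hzy hne hn
    rw [norm_radialRep_sub hu0 hκ, dist_eq_two hxz hzy hne hn]
  · exact mul_pos (by linarith) (by linarith)
  -- The recurrences at distances 0 and 1 express the second difference of `u`, which is
  -- proportional to the squared defect, through `b 1 - 1 - θ`; this is less than `ε * b 1` by the
  -- eigenvalue gap.
  · have h1 : b 1 * (1 - 2 * u 1 + u 2) = (1 - u 1) * (b 1 - 1 - θ) := by
      rw [hkR] at hu1
      linear_combination hu2 - hu1
    have h2 : (1 - u 1) * (b 1 - 1 - θ) ≤ b 1 * (ε * (1 - u 1)) := by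
      nlinarith
    have h3 : 1 - 2 * u 1 + u 2 ≤ ε * (1 - u 1) := by
      rw [← h1] at h2
      exact le_of_mul_le_mul_left h2 hb1R
    nlinarith
  -- As `k = l + b 1 + 1`, the claim reads `b 1 - l - 3 < θ`, which follows from the gap and `ε * k
  -- < l + 1`.
  · nlinarith

end IsDistanceRegularWith

end StandardRepresentation
end SimpleGraph

/-! ### Assembly of the classification. -/

theorem theorem1p3 {V : Type*} [Fintype V] [DecidableEq V]
    (X : SimpleGraph V) [DecidableRel X.Adj]
    (d k : ℕ) (a b c : ℕ → ℕ) (m θ₁ ε : ℝ)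
    (hX : X.IsDistanceRegularWith d a b c) (hk : X.IsRegularOfDegree k)
    (hgeom : X.IsGeometric)
    (hd : 2 ≤ d)
    (hm : X.IsSmallestEigenvalue (-m))
    (hμ : 2 ≤ c 2)
    (hθ₁ : X.IsSecondLargestEigenvalue θ₁)
    (hε₀ : 0 < ε) (hε₁ : ε < 1 / (6 * m ^ 4 * d))
    (hgap : θ₁ ≥ (1 - ε) * b 1)
    (ht : ∃ t : ℕ, t ≤ d ∧ (c t : ℝ) ≤ ε * k ∧ (b t : ℝ) ≤ ε * k)
    (hloc : ∃ v : V, ¬ (X.neighborhoodGraph v).Connected) :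
    ∃ s : ℕ, 2 ≤ s ∧ (s : ℚ) = 1 + (k : ℚ) / (d : ℚ) ∧
      Nonempty (X ≃g SimpleGraph.hammingGraph d s) := by
  open SimpleGraph in
  obtain ⟨x, y, hxy⟩ := hX.exists_dist_eq hd
  obtain ⟨x₀, hx₀y, hxx₀⟩ := exists_adj_dist_eq hX.connected hxy
  have hxx₀' := dist_eq_one_iff_adj.mp hxx₀
  obtain ⟨𝒞, s, h𝒞, hm0, hkm⟩ := hgeom.exists_isCliqueGeometry hk hm hxx₀'
  have hs := h𝒞.two_le
  have : NeZero s := ⟨by omega⟩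
  obtain ⟨v, hv0, hv⟩ := hX.exists_standard_sequence hk hm.1
  obtain ⟨z, hz⟩ := hloc
  have hP := h𝒞.isPartialLinear hX.connected hk hm0 hkm hv0 hv hz
  obtain ⟨σ, F⟩ := h𝒞.exists_isFrame hP x₀
  have hM : 2 ≤ (𝒞.filter (x₀ ∈ ·)).card := by
    refine h𝒞.two_le_card hxx₀'.symm hx₀y ?_ fun h => ?_
    · rintro rfl
      simp at hxy
    · rw [dist_eq_one_iff_adj.mpr h] at hxy
      omega
  have hkM := h𝒞.card_mul hk x₀
  generalize (𝒞.filter (x₀ ∈ ·)).card = M at *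
  have hsR : (2 : ℝ) ≤ s := by exact_mod_cast hs
  have hkM' : (k : ℝ) = M * ((s : ℝ) - 1) := by
    rw [hkM, Nat.cast_mul, Nat.cast_sub (by omega)]; simp
  have hmM : m = M := mul_right_cancel₀ (by linarith) (hkm.symm.trans hkM')
  have hm2 : 2 ≤ m := by rw [hmM]; exact_mod_cast hM
  have hdR : (2 : ℝ) ≤ d := by exact_mod_cast hd
  rw [lt_div_iff₀ (by positivity)] at hε₁
  -- With `m` and `d` at least 2, the bound on ε gives `96 * ε * m < 1`. This yields both `192 * ε ≤
  -- 1` and `ε * k < s - 1`, where `l + 1 = s - 1`.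
  have hm4 : 2 ^ 3 * m ≤ m ^ 4 := by
    rw [show m ^ 4 = m ^ 3 * m by ring]
    gcongr
  have hm4d : 2 ^ 3 * m * 2 ≤ m ^ 4 * d :=
    mul_le_mul hm4 hdR (by norm_num) (by positivity)
  have hεm : ε * (96 * m) ≤ ε * (6 * m ^ 4 * d) :=
    mul_le_mul_of_nonneg_left (by linarith) hε₀.le
  obtain ⟨u, hu0, hu⟩ := hX.exists_standard_sequence hk hθ₁.1.1
  obtain ⟨κ, hκ0, hκ⟩ := hX.exists_sum_standard_mul hu0 hu
  have hθk : θ₁ < k := by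
    obtain ⟨-, η, hη, hlt⟩ := hθ₁.1
    exact hlt.trans_le (le_of_mem_adjEigenvalues hk hη)
  have R := hX.isAlmostParallelogramRep hd hk hμ (h𝒞.diamondFree hP)
    (h𝒞.card_common hP) hθk hgap hε₀ (by nlinarith)
    (by rw [hkm, Nat.cast_sub hs]; push_cast; nlinarith) hu0 hu hκ0 hκ
  obtain ⟨Φ, hΦ⟩ := R.exists_isHammingCovering F hkM hX.connected
  have hdM : d = M := by rw [← hX.diam_eq, hΦ.diam_eq hX.connected hs]
  subst hdM
  refine ⟨s, hs, ?_, ⟨hΦ.iso hX.connected⟩⟩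
  have hdQ : (d : ℚ) ≠ 0 := by
    have : d ≠ 0 := by omega
    exact_mod_cast this
  rw [hkM, Nat.cast_mul, Nat.cast_sub (by omega), mul_div_cancel_left₀ _ hdQ]
  simp
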